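/- Let $a>0$, $b<0$, $\epsilon>0$, $0<T<\infty$, $\gamma\ge 0$ and $\beta\in\mathbb R$. Put $D=\,]a,\infty[$, $\Omega=\,]0,\infty[$, $B=[b-\epsilon,b]$, and $\mathrm{dist}(X,Y)=\inf\{|x-y| : x\in X,\ y\in Y\}$. Let $f\in L^2(\mathbb R)$ be real-valued with $\mathrm{supp}\,f\subset B$, and assume that $$\exists\,\mu\in\mathbb R:\quad \liminf_{\tau\to\infty}\ \tau^{\mu}\left|\int_{b-\epsilon}^{b}e^{-\tau(b-y)}f(y)\,dy\right|>0 .$$ Let $u=u(x,t)$ be the weak solution of $$\begin{aligned}&\partial_t^2u-\partial_x^2u=0 &&\text{in } ]-\infty,a[\,\times\,]0,T[,\\ &u(x,0)=0,\quad \partial_tu(x,0)=f(x) &&\text{in } ]-\infty,a[,\\ &-\partial_xu(a,t)-\gamma\,\partial_tu(a,t)-\beta\,u(a,t)=0, &&0<t<T.\end{aligned}$$ That is, with $Q=\,]-\infty,a[\,\times\,]0,T[$: $u$, $\partial_xu$ and $\partial_tu$ (weak derivatives) belong to $L^2(Q)$; $u$ is continuous on $]-\infty,a]\times[0,T]$;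 $u(x,0)=0$ for $x\le a$; and for every $\varphi\in C_c^\infty(\mathbb R\times\,]-\infty,T[)$ $$\int_Q(\partial_xu\,\partial_x\varphi-\partial_tu\,\partial_t\varphi)\,dx\,dt+\int_0^T\bigl(\beta\,u(a,t)\varphi(a,t)-\gamma\,u(a,t)\,\partial_t\varphi(a,t)\bigr)dt=\int_{-\infty}^af(x)\varphi(x,0)\,dx .$$ For $\tau>0$ set $$w(x,\tau)=\int_0^Te^{-\tau t}u(x,t)\,dt\quad(x<a),\qquad v(x,\tau)=\frac1{2\tau}\int_{-\infty}^{\infty}e^{-\tau|x-y|}f(y)\,dy ,$$ $$I(\tau)=-v'(0,\tau)\,w(0,\tau)+w'(0,\tau)\,v(0,\tau),$$ where $'$ is the derivative in $x$ (both derivatives at $0$ exist). Assume that $$T>2\,\mathrm{dist}(D,B)-\mathrm{dist}(\Omega,B).$$ **(i)** Let $\gamma\neq1$. If $\gamma<1$, then there is $\tau_0>0$ such that $I(\tau)>0$ for all $\tau\ge\tau_0$. If $\gamma>1$, then there is $\tau_0>0$ such that $I(\tau)<0$ for all $\tau\ge\tau_0$. In both cases $$\lim_{\tau\to\infty}\frac1{2\tau}\log|I(\tau)|=-\mathrm{dist}(D,B).$$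 **(ii)** Let $\gamma=1$ and $\beta\neq0$. If $\beta<0$, then there is $\tau_0>0$ such that $I(\tau)>0$ for all $\tau\ge\tau_0$. If $\beta>0$, then there is $\tau_0>0$ such that $I(\tau)<0$ for all $\tau\ge\tau_0$. In both cases $$\lim_{\tau\to\infty}\frac1{2\tau}\log|I(\tau)|=-\mathrm{dist}(D,B).$$ -/

import Mathlib

open Set Filter Topology MeasureTheory
open scoped ContDiff

namespace HalfLineWave

noncomputable section

/-- The distance `inf {|x - y| : x ∈ A, y ∈ B}` between two (nonempty) sets of reals. -/
def setDist (A B : Set ℝ) : ℝ := sInf (Set.image2 dist A B)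

/-- The obstacle `D = ]a, ∞[`. -/
def obstacle (a : ℝ) : Set ℝ := Ioi a

/-- The set `Ω = ]0, ∞[`, at whose boundary point `0` the wave is observed. -/
def observed : Set ℝ := Ioi 0

/-- The interval `B = [b - ε, b]` that carries the initial data. -/
def source (b ε : ℝ) : Set ℝ := Icc (b - ε) b

/-- The space-time domain `]-∞, a[ × ]0, T[`; points are `(x, t)`. -/
def strip (a T : ℝ) : Set (ℝ × ℝ) := Iio a ×ˢ Ioo 0 T

/-- The partial derivative in the space variable. -/
def dx (φ : ℝ × ℝ → ℝ) (z : ℝ × ℝ) : ℝ := deriv (fun x => φ (x, z.2)) z.1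

/-- The partial derivative in the time variable. -/
def dt (φ : ℝ × ℝ → ℝ) (z : ℝ × ℝ) : ℝ := deriv (fun t => φ (z.1, t)) z.2

/-- `φ ∈ C_c^∞(U)`. -/
structure IsTestFunction (U : Set (ℝ × ℝ)) (φ : ℝ × ℝ → ℝ) : Prop where
  smooth : ContDiff ℝ ∞ φ
  compact : HasCompactSupport φ
  support : tsupport φ ⊆ U

/-- `u` is a weak solution (of finite energy on the time interval `]0, T[`) of
`∂ₜ²u - ∂ₓ²u = 0` in `]-∞, a[ × ]0, T[`, `u(x, 0) = 0`, `∂ₜu(x, 0) = f(x)`,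
`-∂ₓu(a, t) - γ ∂ₜu(a, t) - β u(a, t) = 0`.

Here `u, ∂ₓu, ∂ₜu ∈ L²(]-∞, a[ × ]0, T[)`, the derivatives (`ux`, `ut` below) being weak ones, and
`u` is the representative which is continuous up to the boundary, so that the traces `u(x, 0)` and
`u(a, t)` are values of `u`. The test functions of the weak formulation do not have to vanish at
`x = a` nor at `t = 0`; the initial velocity enters through the right-hand side, and the boundary
term `γ ∂ₜu(a, t)` is integrated by parts in time. -/
structure IsWeakSolution (a T γ β : ℝ) (f : ℝ → ℝ) (u : ℝ × ℝ → ℝ) : Prop where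
  continuousOn : ContinuousOn u (Iic a ×ˢ Icc 0 T)
  memLp : MemLp u 2 (volume.restrict (strip a T))
  initial : ∀ x ≤ a, u (x, 0) = 0
  weak : ∃ ux ut : ℝ × ℝ → ℝ,
    MemLp ux 2 (volume.restrict (strip a T)) ∧
    MemLp ut 2 (volume.restrict (strip a T)) ∧
    (∀ φ, IsTestFunction (strip a T) φ →
      ∫ z in strip a T, u z * dx φ z = -∫ z in strip a T, ux z * φ z) ∧
    (∀ φ, IsTestFunction (strip a T) φ →
      ∫ z in strip a T, u z * dt φ z = -∫ z in strip a T, ut z * φ z) ∧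
    (∀ φ, IsTestFunction {z | z.2 < T} φ →
      (∫ z in strip a T, (ux z * dx φ z - ut z * dt φ z))
        + ∫ t in Ioo 0 T, (β * u (a, t) * φ (a, t) - γ * u (a, t) * dt φ (a, t))
      = ∫ x in Iio a, f x * φ (x, 0))

/-- `w(x, τ) = ∫₀ᵀ e^{-τ t} u(x, t) dt`. -/
def w (T : ℝ) (u : ℝ × ℝ → ℝ) (τ x : ℝ) : ℝ :=
  ∫ t in (0 : ℝ)..T, Real.exp (-τ * t) * u (x, t)

/-- `v(x, τ) = (1 / 2τ) ∫ e^{-τ |x - y|} f(y) dy`. -/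
def v (f : ℝ → ℝ) (τ x : ℝ) : ℝ :=
  1 / (2 * τ) * ∫ y, Real.exp (-τ * |x - y|) * f y

/-- `I(τ) = -v'(0, τ) w(0, τ) + w'(0, τ) v(0, τ)`. -/
def indicatorFn (T : ℝ) (f : ℝ → ℝ) (u : ℝ × ℝ → ℝ) (τ : ℝ) : ℝ :=
  -(deriv (v f τ) 0) * w T u τ 0 + deriv (w T u τ) 0 * v f τ 0

/-- There is `μ ∈ ℝ` with `liminf_{τ → ∞} τ^μ |∫_{b-ε}^b e^{-τ (b - y)} f(y) dy| > 0`
(the lower limit is taken in `[0, ∞]`). -/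
def NonDegenerate (b ε : ℝ) (f : ℝ → ℝ) : Prop :=
  ∃ μ : ℝ, 0 < liminf (fun τ : ℝ =>
    ENNReal.ofReal (τ ^ μ * |∫ y in (b - ε)..b, Real.exp (-τ * (b - y)) * f y|)) atTop

end

end HalfLineWave

namespace HalfLineWave

/-! ### Smooth cutoffs and approximate identities -/

/-! Write `F(τ) = ∫ e^{τ y} f(y) dy` (`laplace`). Near `x = 0` one has `v' = -τ v` and `v(0) = F /
(2τ)`, so `I = (F / 2τ) (w' + τ w)` at `0`. By d'Alembert's formula, `u(x, t) = P(x + t) + Q(x - t)`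
for `b < x < a`; the combination `w' + τ w` cancels the incoming wave `Q`, up to endpoint terms, and
keeps twice `τ` times the Laplace transform of the reflected wave `P`. Thus `I` sees only the
reflection at `x = a`.

The reflection is computed exactly. The trace `U(t) = u(a, t)` satisfies `(1 + γ) U' + β U = f(a -
t)` weakly, so its transform is close to `e^{-τ a} F / ((1 + γ) τ + β)`. Combined with the
d'Alembert expression of `P` through `U` and `f`, this gives `w' + τ w ≈ e^{-2τ a} F · ((1 - γ) τ -
β) / ((1 + γ) τ + β)`, with an error `O(τ² e^{-τ T})` once multiplied by the denominator. Hence `I`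
is approximately `F²` times a positive factor times `(1 - γ) τ - β`. The sign is that of `1 - γ`, or
of `-β` when `γ = 1`. As `f` lives on `y ≤ b` and is nondegenerate at `b`, `F` equals `e^{τ b}` up
to powers of `τ`, so the rate is `-(a - b)`. The assumption on `T` says `T > 2a - b`, which is what
makes the error negligible against `e^{-2τ a} F`.

The analytic work is to get both facts from the weak formulation alone. `integral_wave_operator`
moves all derivatives to the test function. Testing with `q(t + a - x)` yields the trace equation
(`trace_ode`, `laplace_trace`); testing with products `p(x + t) q(x - t)` of smoothed steps yields
the change of `u` along a characteristic (`sub_eq_integral`, `eq_reflected_sub`).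
`indicatorFn_asymptotics` assembles the two, and `sign_and_decay` reads off sign and rate. -/

lemma deriv_smoothTransition_eq_zero {s : ℝ} (hs : s ∉ Icc (0 : ℝ) 1) :
    deriv Real.smoothTransition s = 0 := by
  rw [mem_Icc, not_and_or, not_le, not_le] at hs
  rcases hs with hs | hs
  · have : Real.smoothTransition =ᶠ[𝓝 s] fun _ => 0 := by
      filter_upwards [Iio_mem_nhds hs] with y hy
      exact Real.smoothTransition.zero_of_nonpos (le_of_lt hy)
    rw [this.deriv_eq]; simp
  · have : Real.smoothTransition =ᶠ[𝓝 s] fun _ => 1 := by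
      filter_upwards [Ioi_mem_nhds hs] with y hy
      exact Real.smoothTransition.one_of_one_le (le_of_lt hy)
    rw [this.deriv_eq]; simp

lemma contDiff_smoothTransition : ContDiff ℝ ∞ Real.smoothTransition :=
  Real.smoothTransition.contDiff

lemma contDiff_deriv_smoothTransition : ContDiff ℝ ∞ (deriv Real.smoothTransition) :=
  contDiff_smoothTransition.iterate_deriv 1

lemma hasDerivAt_smoothTransition (s : ℝ) :
    HasDerivAt Real.smoothTransition (deriv Real.smoothTransition s) s :=
  (contDiff_smoothTransition.differentiable (by simp) s).hasDerivAt

lemma hasCompactSupport_deriv_smoothTransition :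
    HasCompactSupport (deriv Real.smoothTransition) :=
  HasCompactSupport.intro isCompact_Icc fun _ hs => deriv_smoothTransition_eq_zero hs

lemma integral_deriv_smoothTransition : ∫ s, deriv Real.smoothTransition s = 1 := by
  have h : ∫ s, deriv Real.smoothTransition s = ∫ s in (0 : ℝ)..1, deriv Real.smoothTransition s := by
    rw [intervalIntegral.integral_of_le zero_le_one, ← integral_Icc_eq_integral_Ioc]
    exact (setIntegral_eq_integral_of_forall_compl_eq_zero
      fun s hs => deriv_smoothTransition_eq_zero hs).symm
  rw [h, intervalIntegral.integral_eq_sub_of_hasDerivAt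
    (fun s _ => hasDerivAt_smoothTransition s)
    (contDiff_deriv_smoothTransition.continuous.intervalIntegrable _ _)]
  simp

lemma abs_smoothTransition_le_one (s : ℝ) : |Real.smoothTransition s| ≤ 1 := by
  rw [abs_of_nonneg (Real.smoothTransition.nonneg s)]
  exact Real.smoothTransition.le_one s

lemma tendsto_smoothTransition_mul_sub {s : ℝ} (hs : 0 < s) (c : ℝ) :
    Tendsto (fun n : ℕ => Real.smoothTransition (n * s - c)) atTop (𝓝 1) := by
  refine tendsto_const_nhds.congr' ?_
  filter_upwards [(tendsto_natCast_atTop_atTop.atTop_mul_const hs).eventually_ge_atTop (c + 1)]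
    with n hn
  rw [Real.smoothTransition.one_of_one_le (by linarith)]

lemma tendsto_smoothTransition_mul (s : ℝ) :
    Tendsto (fun n : ℕ => Real.smoothTransition (n * s)) atTop
      (𝓝 ((Ioi (0 : ℝ)).indicator (fun _ => 1) s)) := by
  rcases lt_or_ge 0 s with hs | hs
  · rw [indicator_of_mem (by exact hs)]
    simpa using tendsto_smoothTransition_mul_sub hs 0
  · rw [indicator_of_notMem (by simpa using hs)]
    refine tendsto_const_nhds.congr fun n => ?_
    rw [Real.smoothTransition.zero_of_nonpos
      (mul_nonpos_of_nonneg_of_nonpos (Nat.cast_nonneg n) hs)]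

/-- Substitution `s = e (x - c) - 1`. The shift by `1` and the sign of `e` place the rescaled bump
strictly on one side of `c` when `θ` is supported in `[0, 1]`, which is needed to approach a
boundary from inside. -/
lemma integral_mul_scaled (g θ : ℝ → ℝ) (c : ℝ) {e : ℝ} (he : e ≠ 0) :
    ∫ x, g x * (|e| * θ (e * (x - c) - 1)) = ∫ s, g (c + (s + 1) / e) * θ s := by
  have h1 := integral_sub_right_eq_self (μ := volume)
    (fun x => g (x + c) * (|e| * θ (e * x - 1))) c
  simp only [sub_add_cancel] at h1
  rw [h1]
  have h2 := Measure.integral_comp_mul_left (fun x => g (x / e + c) * (|e| * θ (x - 1))) e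
  simp only [mul_div_cancel_left₀ _ he] at h2
  rw [h2, ← integral_sub_right_eq_self (μ := volume)
    (fun s => g (c + (s + 1) / e) * θ s) 1, smul_eq_mul, ← integral_const_mul]
  congr 1
  ext x
  rw [abs_inv, sub_add_cancel, add_comm c]
  field_simp

/-- An approximate identity in the first variable only. -/
lemma tendsto_integral_scaled_fst {G : ℝ × ℝ → ℝ} (hG : Continuous G) (hGc : HasCompactSupport G)
    {θ : ℝ → ℝ} (hθ : Continuous θ) (hθc : HasCompactSupport θ) (hθ1 : ∫ s, θ s = 1)
    {m : ℕ → ℝ → ℝ} (hm : ∀ n, Continuous (m n)) (hm1 : ∀ n y, |m n y| ≤ 1)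
    {Y : Set ℝ} (hY : MeasurableSet Y) (hmY : ∀ y ∈ Y, Tendsto (fun n => m n y) atTop (𝓝 1))
    {σ : ℝ} (hσ : |σ| = 1) (c : ℝ) :
    Tendsto (fun n : ℕ => ∫ z in univ ×ˢ Y,
        G z * ((n * θ (σ * n * (z.1 - c) - 1)) * m n z.2)) atTop (𝓝 (∫ y in Y, G (c, y))) := by
  obtain ⟨C, hC⟩ := hG.bounded_above_of_compact_support hGc
  simp only [Real.norm_eq_abs] at hC
  have hθi : Integrable θ := hθ.integrable_of_hasCompactSupport hθc
  -- the projection of the support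
  set K : Set ℝ := Prod.snd '' tsupport G with hKdef
  have hK : IsCompact K := hGc.isCompact.image continuous_snd
  have hGK : ∀ x y, y ∉ K → G (x, y) = 0 := fun x y hy => by
    by_contra h
    exact hy ⟨(x, y), subset_tsupport _ h, rfl⟩
  have hσ0 : σ ≠ 0 := by rintro rfl; simp at hσ
  have key : ∀ n : ℕ, 1 ≤ n → ∫ z in univ ×ˢ Y,
        G z * ((n * θ (σ * n * (z.1 - c) - 1)) * m n z.2)
      = ∫ y in Y, m n y * ∫ s, G (c + (s + 1) / (σ * n), y) * θ s := by
    intro n hn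
    have hn0 : (n : ℝ) ≠ 0 := by positivity
    have hcont : Continuous fun z : ℝ × ℝ =>
        G z * ((n * θ (σ * n * (z.1 - c) - 1)) * m n z.2) := by
      have := hm n
      fun_prop
    have hint : Integrable (fun z : ℝ × ℝ =>
        G z * ((n * θ (σ * n * (z.1 - c) - 1)) * m n z.2)) :=
      hcont.integrable_of_hasCompactSupport hGc.mul_right
    -- The concentrating variable is integrated first, so that dominated convergence can be applied
    -- on each slice and then over `Y`.
    rw [Measure.volume_eq_prod, ← Measure.prod_restrict, Measure.restrict_univ, integral_prod_symm]
    · refine integral_congr_ae (ae_of_all _ fun y => ?_)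
      have := integral_mul_scaled (fun x => G (x, y)) θ c (e := σ * n) (mul_ne_zero hσ0 hn0)
      simp only at this ⊢
      rw [← this, ← integral_const_mul]
      congr 1
      ext x
      rw [abs_mul, hσ, Nat.abs_cast]
      ring
    · have := hint.restrict (s := univ ×ˢ Y)
      rwa [Measure.volume_eq_prod, ← Measure.prod_restrict, Measure.restrict_univ] at this
  refine Tendsto.congr' (f₁ := fun n : ℕ =>
      ∫ y in Y, m n y * ∫ s, G (c + (s + 1) / (σ * n), y) * θ s) ?_ ?_
  · filter_upwards [eventually_ge_atTop 1] with n hn using (key n hn).symm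
  refine tendsto_integral_filter_of_dominated_convergence
    (K.indicator fun _ => C * ∫ s, |θ s|) ?_ ?_ ?_ ?_
  · refine Eventually.of_forall fun n => ?_
    have : StronglyMeasurable fun y => ∫ s, G (c + (s + 1) / (σ * n), y) * θ s := by
      apply StronglyMeasurable.integral_prod_right
        (f := fun y s => G (c + (s + 1) / (σ * n), y) * θ s)
      apply Continuous.stronglyMeasurable
      fun_prop
    exact ((hm n).stronglyMeasurable.mul this).aestronglyMeasurable
  · refine Eventually.of_forall fun n => ae_of_all _ fun y => ?_
    by_cases hy : y ∈ K
    · rw [indicator_of_mem hy, norm_mul, Real.norm_eq_abs, ← one_mul (C * _)]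
      refine mul_le_mul (hm1 n y) ?_ (norm_nonneg _) zero_le_one
      rw [← integral_const_mul]
      refine norm_integral_le_of_norm_le (hθi.abs.const_mul C) (ae_of_all _ fun s => ?_)
      rw [norm_mul]
      exact mul_le_mul_of_nonneg_right (hC _) (abs_nonneg _)
    · simp [hGK _ y hy, hy]
  · exact ((integrable_indicator_iff hK.measurableSet).2
      (integrableOn_const hK.measure_lt_top.ne)).restrict
  · filter_upwards [ae_restrict_mem hY] with y hy
    have hlim : Tendsto (fun n : ℕ => ∫ s, G (c + (s + 1) / (σ * n), y) * θ s) atTop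
        (𝓝 (∫ s, G (c, y) * θ s)) := by
      refine tendsto_integral_filter_of_dominated_convergence (fun s => C * |θ s|) ?_ ?_
        (hθi.abs.const_mul C) ?_
      · refine Eventually.of_forall fun n => Continuous.aestronglyMeasurable ?_
        fun_prop
      · refine Eventually.of_forall fun n => ae_of_all _ fun s => ?_
        rw [norm_mul]
        exact mul_le_mul_of_nonneg_right (hC _) (abs_nonneg _)
      · refine ae_of_all _ fun s => Tendsto.mul_const _ ?_
        refine (hG.tendsto (c, y)).comp (Tendsto.prodMk_nhds ?_ tendsto_const_nhds)
        have : Tendsto (fun n : ℕ => (s + 1) / σ / (n : ℝ)) atTop (𝓝 0) :=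
          tendsto_const_nhds.div_atTop tendsto_natCast_atTop_atTop
        simpa [div_div] using this.const_add c
    rw [integral_const_mul, hθ1, mul_one] at hlim
    simpa using (hmY y hy).mul hlim

/-! ### Partial derivatives of smooth functions -/

lemma hasDerivAt_slice_fst {φ : ℝ × ℝ → ℝ} (h : ContDiff ℝ ∞ φ) (z : ℝ × ℝ) :
    HasDerivAt (fun x => φ (x, z.2)) (fderiv ℝ φ z (1, 0)) z.1 :=
  (h.differentiable (by simp) z).hasFDerivAt.comp_hasDerivAt z.1
    ((hasDerivAt_id z.1).prodMk (hasDerivAt_const z.1 z.2))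

lemma hasDerivAt_slice_snd {φ : ℝ × ℝ → ℝ} (h : ContDiff ℝ ∞ φ) (z : ℝ × ℝ) :
    HasDerivAt (fun t => φ (z.1, t)) (fderiv ℝ φ z (0, 1)) z.2 :=
  (h.differentiable (by simp) z).hasFDerivAt.comp_hasDerivAt z.2
    ((hasDerivAt_const z.2 z.1).prodMk (hasDerivAt_id z.2))

lemma dx_eq_fderiv {φ : ℝ × ℝ → ℝ} (h : ContDiff ℝ ∞ φ) : dx φ = fun z => fderiv ℝ φ z (1, 0) :=
  funext fun z => (hasDerivAt_slice_fst h z).deriv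

lemma dt_eq_fderiv {φ : ℝ × ℝ → ℝ} (h : ContDiff ℝ ∞ φ) : dt φ = fun z => fderiv ℝ φ z (0, 1) :=
  funext fun z => (hasDerivAt_slice_snd h z).deriv

lemma hasDerivAt_dx {φ : ℝ × ℝ → ℝ} (h : ContDiff ℝ ∞ φ) (z : ℝ × ℝ) :
    HasDerivAt (fun x => φ (x, z.2)) (dx φ z) z.1 := by
  rw [dx_eq_fderiv h]; exact hasDerivAt_slice_fst h z

lemma hasDerivAt_dt {φ : ℝ × ℝ → ℝ} (h : ContDiff ℝ ∞ φ) (z : ℝ × ℝ) :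
    HasDerivAt (fun t => φ (z.1, t)) (dt φ z) z.2 := by
  rw [dt_eq_fderiv h]; exact hasDerivAt_slice_snd h z

lemma contDiff_dx {φ : ℝ × ℝ → ℝ} (h : ContDiff ℝ ∞ φ) : ContDiff ℝ ∞ (dx φ) := by
  rw [dx_eq_fderiv h]
  exact (h.fderiv_right (m := ∞) (by simp)).clm_apply contDiff_const

lemma contDiff_dt {φ : ℝ × ℝ → ℝ} (h : ContDiff ℝ ∞ φ) : ContDiff ℝ ∞ (dt φ) := by
  rw [dt_eq_fderiv h]
  exact (h.fderiv_right (m := ∞) (by simp)).clm_apply contDiff_const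

lemma IsTestFunction.dx {A : Set (ℝ × ℝ)} {φ : ℝ × ℝ → ℝ} (h : IsTestFunction A φ) :
    IsTestFunction A (dx φ) where
  smooth := contDiff_dx h.smooth
  compact := by rw [dx_eq_fderiv h.smooth]; exact h.compact.fderiv_apply ℝ (1, 0)
  support := by
    rw [dx_eq_fderiv h.smooth]
    exact (tsupport_fderiv_apply_subset ℝ (1, 0)).trans h.support

lemma IsTestFunction.dt {A : Set (ℝ × ℝ)} {φ : ℝ × ℝ → ℝ} (h : IsTestFunction A φ) :
    IsTestFunction A (dt φ) where
  smooth := contDiff_dt h.smooth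
  compact := by rw [dt_eq_fderiv h.smooth]; exact h.compact.fderiv_apply ℝ (0, 1)
  support := by
    rw [dt_eq_fderiv h.smooth]
    exact (tsupport_fderiv_apply_subset ℝ (0, 1)).trans h.support

lemma dx_eventuallyEq {φ ψ : ℝ × ℝ → ℝ} {z : ℝ × ℝ} (h : φ =ᶠ[𝓝 z] ψ) :
    dx φ =ᶠ[𝓝 z] dx ψ := by
  filter_upwards [h.eventuallyEq_nhds] with y hy
  refine EventuallyEq.deriv_eq ?_
  have : Tendsto (fun x : ℝ => (x, y.2)) (𝓝 y.1) (𝓝 y) :=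
    (continuous_id.prodMk continuous_const).tendsto' _ _ rfl
  exact this.eventually hy

lemma dt_eventuallyEq {φ ψ : ℝ × ℝ → ℝ} {z : ℝ × ℝ} (h : φ =ᶠ[𝓝 z] ψ) :
    dt φ =ᶠ[𝓝 z] dt ψ := by
  filter_upwards [h.eventuallyEq_nhds] with y hy
  refine EventuallyEq.deriv_eq ?_
  have : Tendsto (fun t : ℝ => (y.1, t)) (𝓝 y.2) (𝓝 y) :=
    (continuous_const.prodMk continuous_id).tendsto' _ _ rfl
  exact this.eventually hy

/-! ### Integration by parts up to the boundary -/

/-- A smooth cutoff, with values in `[0, 1]`, to the points of `strip a T` at distance `≥ 1 / n`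
from the lines `x = a` and `t = 0`. -/
noncomputable def cut (a : ℝ) (n : ℕ) (z : ℝ × ℝ) : ℝ :=
  Real.smoothTransition (-1 * n * (z.1 - a) - 1) * Real.smoothTransition (1 * n * (z.2 - 0) - 1)

lemma contDiff_cut (a : ℝ) (n : ℕ) : ContDiff ℝ ∞ (cut a n) := by
  unfold cut
  have h := contDiff_smoothTransition
  exact (h.comp (by fun_prop)).mul (h.comp (by fun_prop))

lemma abs_cut_le_one (a : ℝ) (n : ℕ) (z : ℝ × ℝ) : |cut a n z| ≤ 1 := by
  rw [cut, abs_mul]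
  exact mul_le_one₀ (abs_smoothTransition_le_one _) (abs_nonneg _) (abs_smoothTransition_le_one _)

lemma tendsto_cut {a T : ℝ} {z : ℝ × ℝ} (hz : z ∈ strip a T) :
    Tendsto (fun n => cut a n z) atTop (𝓝 1) := by
  have h1 := tendsto_smoothTransition_mul_sub (s := a - z.1) (by have := hz.1; simp at this; linarith) 1
  have h2 := tendsto_smoothTransition_mul_sub (s := z.2) hz.2.1 1
  have := h1.mul h2
  simp only [mul_one] at this
  refine this.congr fun n => ?_
  rw [cut]
  congr 2 <;> ring

/-- The cutoff removes neighbourhoods of `x = a` and `t = 0`, so the definition of weak derivative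
becomes applicable to test functions that do not vanish there. Near `t = T` the support of `ψ`
already suffices. -/
lemma isTestFunction_mul_cut {a T : ℝ} {ψ : ℝ × ℝ → ℝ} (hψ : IsTestFunction {z | z.2 < T} ψ)
    {n : ℕ} (hn : 0 < n) : IsTestFunction (strip a T) (fun z => ψ z * cut a n z) where
  smooth := hψ.smooth.mul (contDiff_cut a n)
  compact := hψ.compact.mul_right
  support := by
    have hn' : (0 : ℝ) < n := by exact_mod_cast hn
    intro z hz
    have h1 : z.2 < T := hψ.support (tsupport_mul_subset_left hz)
    have h2 : z ∈ {z : ℝ × ℝ | 1 ≤ n * (a - z.1) ∧ 1 ≤ n * z.2} := by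
      refine closure_minimal ?_ ?_ (tsupport_mul_subset_right hz)
      · intro y hy
        rw [Function.mem_support, cut, mul_ne_zero_iff] at hy
        constructor <;> by_contra hc <;> push Not at hc
        · exact hy.1 (Real.smoothTransition.zero_of_nonpos (by linarith))
        · exact hy.2 (Real.smoothTransition.zero_of_nonpos (by linarith))
      · have c1 : Continuous fun z : ℝ × ℝ => n * (a - z.1) := by fun_prop
        have c2 : Continuous fun z : ℝ × ℝ => n * z.2 := by fun_prop
        exact (isClosed_le continuous_const c1).inter (isClosed_le continuous_const c2)
    refine ⟨?_, ?_, h1⟩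
    · have : 0 < a - z.1 := pos_of_mul_pos_right (lt_of_lt_of_le one_pos h2.1) hn'.le
      simpa using this
    · exact pos_of_mul_pos_right (lt_of_lt_of_le one_pos h2.2) hn'.le

lemma measurableSet_strip (a T : ℝ) : MeasurableSet (strip a T) :=
  measurableSet_Iio.prod measurableSet_Ioo

lemma tendsto_integral_mul_cut {a T : ℝ} {g : ℝ × ℝ → ℝ} (hg : IntegrableOn g (strip a T)) :
    Tendsto (fun n => ∫ z in strip a T, g z * cut a n z) atTop (𝓝 (∫ z in strip a T, g z)) := by
  refine tendsto_integral_of_dominated_convergence (fun z => |g z|) ?_ hg.abs ?_ ?_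
  · exact fun n => hg.aestronglyMeasurable.mul (contDiff_cut a n).continuous.aestronglyMeasurable
  · refine fun n => ae_of_all _ fun z => ?_
    rw [norm_mul, ← mul_one |g z|]
    exact mul_le_mul_of_nonneg_left (abs_cut_le_one a n z) (abs_nonneg _)
  · filter_upwards [ae_restrict_mem (measurableSet_strip a T)] with z hz
    simpa using (tendsto_cut hz).const_mul (g z)

lemma integrableOn_mul_of_memLp {a T : ℝ} {g ψ : ℝ × ℝ → ℝ}
    (hg : MemLp g 2 (volume.restrict (strip a T))) (hψ : Continuous ψ) (hc : HasCompactSupport ψ) :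
    IntegrableOn (fun z => g z * ψ z) (strip a T) :=
  hg.integrable_mul (q := 2) ((hψ.memLp_of_hasCompactSupport hc).restrict _)

lemma dx_mul_cut {ψ : ℝ × ℝ → ℝ} (hψ : ContDiff ℝ ∞ ψ) (a : ℝ) (n : ℕ) (z : ℝ × ℝ) :
    dx (fun z => ψ z * cut a n z) z = dx ψ z * cut a n z
      - ψ z * ((n * deriv Real.smoothTransition (-1 * n * (z.1 - a) - 1))
        * Real.smoothTransition (1 * n * (z.2 - 0) - 1)) := by
  have h1 : HasDerivAt (fun x : ℝ => -1 * n * (x - a) - 1) (-1 * n * 1 : ℝ) z.1 :=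
    (((hasDerivAt_id z.1).sub_const a).const_mul _).sub_const _
  have h2 := (hasDerivAt_smoothTransition (-1 * n * (z.1 - a) - 1)).comp z.1 h1
  have h3 := (hasDerivAt_dx hψ z).mul
    (h2.mul_const (Real.smoothTransition (1 * n * (z.2 - 0) - 1)))
  refine h3.deriv.trans ?_
  simp only [cut, Function.comp]
  ring

lemma dt_mul_cut {ψ : ℝ × ℝ → ℝ} (hψ : ContDiff ℝ ∞ ψ) (a : ℝ) (n : ℕ) (z : ℝ × ℝ) :
    dt (fun z => ψ z * cut a n z) z = dt ψ z * cut a n z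
      + ψ z * ((n * deriv Real.smoothTransition (1 * n * (z.2 - 0) - 1))
        * Real.smoothTransition (-1 * n * (z.1 - a) - 1)) := by
  have h1 : HasDerivAt (fun t : ℝ => 1 * n * (t - 0) - 1) (1 * n * 1 : ℝ) z.2 :=
    (((hasDerivAt_id z.2).sub_const 0).const_mul _).sub_const _
  have h2 := (hasDerivAt_smoothTransition (1 * n * (z.2 - 0) - 1)).comp z.2 h1
  have h3 := (hasDerivAt_dt hψ z).mul
    (h2.const_mul (Real.smoothTransition (-1 * n * (z.1 - a) - 1)))
  refine h3.deriv.trans ?_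
  simp only [cut, Function.comp]
  ring

lemma continuous_scaled_smoothTransition (σ c : ℝ) (n : ℕ) :
    Continuous fun y : ℝ => Real.smoothTransition (σ * n * (y - c) - 1) :=
  contDiff_smoothTransition.continuous.comp (by fun_prop)

lemma continuous_scaled_deriv_smoothTransition (σ c : ℝ) (n : ℕ) :
    Continuous fun y : ℝ => deriv Real.smoothTransition (σ * n * (y - c) - 1) :=
  contDiff_deriv_smoothTransition.continuous.comp (by fun_prop)

/-- Test the weak derivative with `ψ · cut` and let `n → ∞`. The `x`-derivative of the cutoff is an
approximate identity at `x = a`, and continuity of `U` turns it into the trace term. -/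
lemma weak_dx_up_to_boundary {a T : ℝ} {U ux : ℝ × ℝ → ℝ} (hU : Continuous U)
    (hux : MemLp ux 2 (volume.restrict (strip a T)))
    (h : ∀ φ, IsTestFunction (strip a T) φ →
      ∫ z in strip a T, U z * dx φ z = -∫ z in strip a T, ux z * φ z)
    {ψ : ℝ × ℝ → ℝ} (hψ : IsTestFunction {z | z.2 < T} ψ) :
    ∫ z in strip a T, ux z * ψ z
      = -(∫ z in strip a T, U z * dx ψ z) + ∫ t in Ioo 0 T, U (a, t) * ψ (a, t) := by
  have hψc := hψ.smooth.continuous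
  have hdψc := hψ.dx.smooth.continuous
  have l1 := tendsto_integral_mul_cut (integrableOn_mul_of_memLp hux hψc hψ.compact)
  have i2 : Integrable (fun z => U z * dx ψ z) :=
    (hU.mul hdψc).integrable_of_hasCompactSupport hψ.dx.compact.mul_left
  have l2 := tendsto_integral_mul_cut (a := a) (T := T) i2.integrableOn
  have l3 := tendsto_integral_scaled_fst (G := fun z => U z * ψ z) (hU.mul hψc)
    hψ.compact.mul_left contDiff_deriv_smoothTransition.continuous
    hasCompactSupport_deriv_smoothTransition integral_deriv_smoothTransition
    (m := fun n y => Real.smoothTransition (1 * n * (y - 0) - 1))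
    (fun n => continuous_scaled_smoothTransition _ _ _)
    (fun n y => abs_smoothTransition_le_one _) (Y := Ioo 0 T) measurableSet_Ioo
    (fun y hy => by simpa using tendsto_smoothTransition_mul_sub hy.1 1) (σ := -1) (by simp) a
  refine tendsto_nhds_unique l1 ((l2.neg.add l3).congr' ?_)
  filter_upwards [eventually_gt_atTop 0] with n hn
  have hn' : (0 : ℝ) < n := by exact_mod_cast hn
  have e1 : ∫ z in strip a T, ux z * ψ z * cut a n z
      = ∫ z in strip a T, ux z * (ψ z * cut a n z) := by simp only [mul_assoc]
  rw [e1, ← neg_eq_iff_eq_neg.2 (h _ (isTestFunction_mul_cut hψ hn))]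
  -- The bump lives strictly to the left of `a`, so integrating over all `x` changes nothing.
  have e2 : ∫ z in univ ×ˢ Ioo 0 T, U z * ψ z *
      ((n * deriv Real.smoothTransition (-1 * n * (z.1 - a) - 1)) *
        Real.smoothTransition (1 * n * (z.2 - 0) - 1)) = ∫ z in strip a T, U z * ψ z *
      ((n * deriv Real.smoothTransition (-1 * n * (z.1 - a) - 1)) *
        Real.smoothTransition (1 * n * (z.2 - 0) - 1)) := by
    refine setIntegral_eq_of_subset_of_forall_sdiff_eq_zero (E := ℝ) (s := strip a T)
      (MeasurableSet.univ.prod measurableSet_Ioo)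
      (prod_mono (subset_univ _) subset_rfl) ?_
    rintro z ⟨hz1, hz2⟩
    have : a ≤ z.1 := by
      by_contra hc
      exact hz2 ⟨not_le.1 hc, hz1.2⟩
    rw [deriv_smoothTransition_eq_zero]
    · simp
    · intro hc
      have := mul_nonneg hn'.le (sub_nonneg.2 this)
      linarith [hc.1]
  have i3 : Integrable (fun z : ℝ × ℝ => U z * ψ z *
      ((n * deriv Real.smoothTransition (-1 * n * (z.1 - a) - 1)) *
        Real.smoothTransition (1 * n * (z.2 - 0) - 1))) := by
    refine Continuous.integrable_of_hasCompactSupport ?_ hψ.compact.mul_left.mul_right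
    exact (hU.mul hψc).mul ((continuous_const.mul
      ((continuous_scaled_deriv_smoothTransition _ _ _).comp continuous_fst)).mul
        ((continuous_scaled_smoothTransition _ _ _).comp continuous_snd))
  have i2' : Integrable (fun z => U z * dx ψ z * cut a n z) :=
    ((hU.mul hdψc).mul (contDiff_cut a n).continuous).integrable_of_hasCompactSupport
      hψ.dx.compact.mul_left.mul_right
  rw [e2, neg_add_eq_sub, ← integral_sub i3.integrableOn i2'.integrableOn, ← integral_neg]
  refine integral_congr_ae (ae_of_all _ fun z => ?_)
  simp only [dx_mul_cut hψ.smooth]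
  ring

/-- The same argument with the coordinates swapped: the approximate identity now sits at `t = 0`,
where `U` vanishes, so no boundary term survives. -/
lemma weak_dt_up_to_boundary {a T : ℝ} {U ut : ℝ × ℝ → ℝ} (hU : Continuous U)
    (hU0 : ∀ x, U (x, 0) = 0)
    (hut : MemLp ut 2 (volume.restrict (strip a T)))
    (h : ∀ φ, IsTestFunction (strip a T) φ →
      ∫ z in strip a T, U z * dt φ z = -∫ z in strip a T, ut z * φ z)
    {ψ : ℝ × ℝ → ℝ} (hψ : IsTestFunction {z | z.2 < T} ψ) :
    ∫ z in strip a T, ut z * ψ z = -(∫ z in strip a T, U z * dt ψ z) := by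
  have hψc := hψ.smooth.continuous
  have hdψc := hψ.dt.smooth.continuous
  have l1 := tendsto_integral_mul_cut (integrableOn_mul_of_memLp hut hψc hψ.compact)
  have i2 : Integrable (fun z => U z * dt ψ z) :=
    (hU.mul hdψc).integrable_of_hasCompactSupport hψ.dt.compact.mul_left
  have l2 := tendsto_integral_mul_cut (a := a) (T := T) i2.integrableOn
  have hsw : HasCompactSupport (fun z : ℝ × ℝ => U z.swap * ψ z.swap) :=
    (hψ.compact.mul_left (f := U)).comp_homeomorph (Homeomorph.prodComm ℝ ℝ)
  have l3 := tendsto_integral_scaled_fst (G := fun z => U z.swap * ψ z.swap)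
    ((hU.comp continuous_swap).mul (hψc.comp continuous_swap))
    hsw contDiff_deriv_smoothTransition.continuous
    hasCompactSupport_deriv_smoothTransition integral_deriv_smoothTransition
    (m := fun n y => Real.smoothTransition (-1 * n * (y - a) - 1))
    (fun n => continuous_scaled_smoothTransition _ _ _)
    (fun n y => abs_smoothTransition_le_one _) (Y := Iio a) measurableSet_Iio
    (fun y hy => by
      have := tendsto_smoothTransition_mul_sub (sub_pos.2 hy) 1
      refine this.congr fun n => ?_
      congr 1; ring) (σ := 1) (by simp) 0
  simp only [Prod.swap_prod_mk, hU0, zero_mul, integral_zero] at l3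
  have l4 := l2.neg.sub l3
  rw [sub_zero] at l4
  refine tendsto_nhds_unique l1 (l4.congr' ?_)
  filter_upwards [eventually_gt_atTop 0] with n hn
  have hn' : (0 : ℝ) < n := by exact_mod_cast hn
  have e1 : ∫ z in strip a T, ut z * ψ z * cut a n z
      = ∫ z in strip a T, ut z * (ψ z * cut a n z) := by simp only [mul_assoc]
  rw [e1, ← neg_eq_iff_eq_neg.2 (h _ (isTestFunction_mul_cut hψ hn))]
  have e2 : ∫ z in univ ×ˢ Iio a, U z.swap * ψ z.swap *
      ((n * deriv Real.smoothTransition (1 * n * (z.1 - 0) - 1)) *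
        Real.smoothTransition (-1 * n * (z.2 - a) - 1)) = ∫ z in strip a T, U z * ψ z *
      ((n * deriv Real.smoothTransition (1 * n * (z.2 - 0) - 1)) *
        Real.smoothTransition (-1 * n * (z.1 - a) - 1)) := by
    have hswap := setIntegral_prod_swap (μ := volume) (ν := volume) (Iio a) univ
      (fun z : ℝ × ℝ => U z * ψ z *
        ((n * deriv Real.smoothTransition (1 * n * (z.2 - 0) - 1)) *
          Real.smoothTransition (-1 * n * (z.1 - a) - 1)))
    rw [← Measure.volume_eq_prod] at hswap
    refine hswap.trans ?_
    refine setIntegral_eq_of_subset_of_forall_sdiff_eq_zero (E := ℝ) (s := strip a T)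
      (measurableSet_Iio.prod MeasurableSet.univ)
      (prod_mono subset_rfl (subset_univ _)) ?_
    rintro z ⟨hz1, hz2⟩
    by_cases hz : z.2 < T
    · have : z.2 ≤ 0 := by
        by_contra hc
        exact hz2 ⟨hz1.1, not_le.1 hc, hz⟩
      rw [deriv_smoothTransition_eq_zero]
      · simp
      · intro hc
        have := mul_nonneg hn'.le (neg_nonneg.2 this)
        linarith [hc.1]
    · rw [show ψ z = 0 from by_contra fun hc => hz (hψ.support (subset_tsupport _ hc))]
      simp
  have i3 : Integrable (fun z : ℝ × ℝ => U z * ψ z *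
      ((n * deriv Real.smoothTransition (1 * n * (z.2 - 0) - 1)) *
        Real.smoothTransition (-1 * n * (z.1 - a) - 1))) := by
    refine Continuous.integrable_of_hasCompactSupport ?_ hψ.compact.mul_left.mul_right
    exact (hU.mul hψc).mul ((continuous_const.mul
      ((continuous_scaled_deriv_smoothTransition _ _ _).comp continuous_snd)).mul
        ((continuous_scaled_smoothTransition _ _ _).comp continuous_fst))
  have i2' : Integrable (fun z => U z * dt ψ z * cut a n z) :=
    ((hU.mul hdψc).mul (contDiff_cut a n).continuous).integrable_of_hasCompactSupport
      hψ.dt.compact.mul_left.mul_right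
  rw [e2, ← neg_add', ← integral_add i2'.integrableOn i3.integrableOn]
  congr 1
  refine integral_congr_ae (ae_of_all _ fun z => ?_)
  simp only [dt_mul_cut hψ.smooth]
  ring

/-! ### The weak formulation with all derivatives on the test function -/

/-- The extension of `u` from `]-∞, a] × [0, T]` that is constant in the outward directions. -/
def clampExt (a T : ℝ) (u : ℝ × ℝ → ℝ) (z : ℝ × ℝ) : ℝ :=
  u (min z.1 a, max 0 (min z.2 T))

section clampExt

variable {a T γ β : ℝ} {f : ℝ → ℝ} {u : ℝ × ℝ → ℝ}

lemma clampExt_eq {z : ℝ × ℝ} (hx : z.1 ≤ a) (ht : z.2 ∈ Icc 0 T) : clampExt a T u z = u z := by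
  rw [clampExt, min_eq_left hx, min_eq_left ht.2, max_eq_right ht.1]

lemma continuous_clampExt (hT : 0 ≤ T) (hu : ContinuousOn u (Iic a ×ˢ Icc 0 T)) :
    Continuous (clampExt a T u) :=
  hu.comp_continuous (by fun_prop) fun z =>
    ⟨min_le_right z.1 a, le_max_left _ _, max_le hT (min_le_right _ _)⟩

lemma clampExt_of_nonpos (h0 : ∀ x ≤ a, u (x, 0) = 0) {x t : ℝ} (ht : t ≤ 0) :
    clampExt a T u (x, t) = 0 := by
  rw [clampExt, max_eq_left ((min_le_left _ _).trans ht)]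
  exact h0 _ (min_le_right _ _)

/-- Applying the two integrations by parts to `dx φ` and `dt φ` leaves only the continuous function
`u` in the formula, so the weak derivatives play no further role. -/
lemma IsWeakSolution.integral_wave_operator (hu : IsWeakSolution a T γ β f u) (hT : 0 < T)
    {φ : ℝ × ℝ → ℝ} (hφ : IsTestFunction {z | z.2 < T} φ) :
    (∫ z in strip a T, clampExt a T u z * (dt (dt φ) z - dx (dx φ) z))
      + ∫ t in Ioo 0 T, clampExt a T u (a, t) *
          (dx φ (a, t) + β * φ (a, t) - γ * dt φ (a, t))
      = ∫ x in Iio a, f x * φ (x, 0) := by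
  obtain ⟨ux, ut, hux, hut, hx, ht, hw⟩ := hu.weak
  have hU : Continuous (clampExt a T u) := continuous_clampExt hT.le hu.continuousOn
  have hUu : ∀ z ∈ strip a T, clampExt a T u z = u z := fun z hz =>
    clampExt_eq (le_of_lt hz.1) (Ioo_subset_Icc_self hz.2)
  have hx' : ∀ φ, IsTestFunction (strip a T) φ →
      ∫ z in strip a T, clampExt a T u z * dx φ z = -∫ z in strip a T, ux z * φ z := by
    intro φ hφ
    rw [← hx φ hφ]
    exact setIntegral_congr_fun (measurableSet_strip a T) fun z hz => by simp only [hUu z hz]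
  have ht' : ∀ φ, IsTestFunction (strip a T) φ →
      ∫ z in strip a T, clampExt a T u z * dt φ z = -∫ z in strip a T, ut z * φ z := by
    intro φ hφ
    rw [← ht φ hφ]
    exact setIntegral_congr_fun (measurableSet_strip a T) fun z hz => by simp only [hUu z hz]
  have h1 := weak_dx_up_to_boundary hU hux hx' hφ.dx
  have h2 := weak_dt_up_to_boundary hU (fun x => clampExt_of_nonpos hu.initial le_rfl) hut ht' hφ.dt
  have h3 := hw φ hφ
  rw [integral_sub (integrableOn_mul_of_memLp hux hφ.dx.smooth.continuous hφ.dx.compact)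
    (integrableOn_mul_of_memLp hut hφ.dt.smooth.continuous hφ.dt.compact), h1, h2] at h3
  have i1 : Integrable (fun z => clampExt a T u z * dt (dt φ) z) :=
    (hU.mul hφ.dt.dt.smooth.continuous).integrable_of_hasCompactSupport hφ.dt.dt.compact.mul_left
  have i2 : Integrable (fun z => clampExt a T u z * dx (dx φ) z) :=
    (hU.mul hφ.dx.dx.smooth.continuous).integrable_of_hasCompactSupport hφ.dx.dx.compact.mul_left
  have e1 : ∫ t in Ioo 0 T, (β * u (a, t) * φ (a, t) - γ * u (a, t) * dt φ (a, t))
      = ∫ t in Ioo 0 T, clampExt a T u (a, t) * (β * φ (a, t) - γ * dt φ (a, t)) := by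
    refine setIntegral_congr_fun measurableSet_Ioo fun t ht => ?_
    simp only [clampExt_eq (u := u) (z := (a, t)) le_rfl (Ioo_subset_Icc_self ht)]
    ring
  have hc : Continuous fun t : ℝ => (a, t) := by fun_prop
  have j : ∀ g : ℝ → ℝ, Continuous g → IntegrableOn g (Ioo 0 T) := fun g hg =>
    (hg.integrableOn_Icc (a := 0) (b := T)).mono_set Ioo_subset_Icc_self
  have e2 : ∫ t in Ioo 0 T, clampExt a T u (a, t) *
          (dx φ (a, t) + β * φ (a, t) - γ * dt φ (a, t))
      = (∫ t in Ioo 0 T, clampExt a T u (a, t) * dx φ (a, t))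
        + ∫ t in Ioo 0 T, clampExt a T u (a, t) * (β * φ (a, t) - γ * dt φ (a, t)) := by
    rw [← integral_add]
    · refine integral_congr_ae (ae_of_all _ fun t => ?_)
      simp only; ring
    · exact j _ ((hU.comp hc).mul (hφ.dx.smooth.continuous.comp hc))
    · exact j _ ((hU.comp hc).mul ((continuous_const.mul (hφ.smooth.continuous.comp hc)).sub
        (continuous_const.mul (hφ.dt.smooth.continuous.comp hc))))
  rw [e1] at h3
  have e3 : ∫ z in strip a T, clampExt a T u z * (dt (dt φ) z - dx (dx φ) z)
      = (∫ z in strip a T, clampExt a T u z * dt (dt φ) z)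
        - ∫ z in strip a T, clampExt a T u z * dx (dx φ) z := by
    simp only [mul_sub]
    exact integral_sub i1.integrableOn i2.integrableOn
  rw [e2, e3, ← h3]
  ring

/-- The weak formulation for test functions whose support is only restricted near the closed
quarter plane `x ≤ a`, `t ≥ 0`. -/
lemma IsWeakSolution.integral_wave_operator' (hu : IsWeakSolution a T γ β f u) (hT : 0 < T)
    {φ : ℝ × ℝ → ℝ} (hφ : ContDiff ℝ ∞ φ) {R T' δ : ℝ} (hT' : T' < T)
    (hδ : 0 < δ) (hsupp : ∀ x ≤ a + δ, ∀ t ≥ -1, φ (x, t) ≠ 0 → R ≤ x ∧ t ≤ T') :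
    (∫ z in strip a T, clampExt a T u z * (dt (dt φ) z - dx (dx φ) z))
      + ∫ t in Ioo 0 T, clampExt a T u (a, t) *
          (dx φ (a, t) + β * φ (a, t) - γ * dt φ (a, t))
      = ∫ x in Iio a, f x * φ (x, 0) := by
  -- The two factors equal `1` for `x ≤ a + δ / 2` and `t ≥ -1 / 2`, a neighbourhood of the closed
  -- quarter plane, so `χ` and `φ` have the same derivatives wherever they are evaluated.
  set χ : ℝ × ℝ → ℝ := fun z => φ z *
    (Real.smoothTransition (2 * ((a + δ - z.1) / δ)) * Real.smoothTransition (2 * (z.2 + 1))) with hχ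
  have hχs : tsupport χ ⊆ Icc R (a + δ) ×ˢ Icc (-1) T' := by
    refine closure_minimal ?_ (isClosed_Icc.prod isClosed_Icc)
    intro z hz
    rw [Function.mem_support, hχ, mul_ne_zero_iff, mul_ne_zero_iff] at hz
    have h1 : z.1 ≤ a + δ := by
      by_contra hc
      have := div_nonpos_of_nonpos_of_nonneg (show a + δ - z.1 ≤ 0 by linarith) hδ.le
      exact hz.2.1 (Real.smoothTransition.zero_of_nonpos (by linarith))
    have h2 : -1 ≤ z.2 := by
      by_contra hc
      exact hz.2.2 (Real.smoothTransition.zero_of_nonpos (by linarith))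
    have h3 := hsupp z.1 h1 z.2 h2 hz.1
    exact ⟨⟨h3.1, h1⟩, h2, h3.2⟩
  have htest : IsTestFunction {z | z.2 < T} χ := by
    refine ⟨hφ.mul ((contDiff_smoothTransition.comp (by fun_prop)).mul
      (contDiff_smoothTransition.comp (by fun_prop))), ?_, fun z hz => ?_⟩
    · exact HasCompactSupport.intro (isCompact_Icc.prod isCompact_Icc) fun z hz =>
        image_eq_zero_of_notMem_tsupport fun h => hz (hχs h)
    · exact lt_of_le_of_lt (hχs hz).2.2 hT'
  have heq : ∀ z : ℝ × ℝ, z.1 ≤ a → 0 ≤ z.2 → χ =ᶠ[𝓝 z] φ := by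
    intro z h1 h2
    have o1 : ∀ᶠ y : ℝ × ℝ in 𝓝 z, y.1 < a + δ / 2 :=
      continuous_fst.continuousAt.eventually_lt continuousAt_const (by linarith)
    have o2 : ∀ᶠ y : ℝ × ℝ in 𝓝 z, -(1 / 2) < y.2 :=
      continuousAt_const.eventually_lt continuous_snd.continuousAt (by linarith)
    filter_upwards [o1, o2] with y hy1 hy2
    have h3 : 1 / 2 ≤ (a + δ - y.1) / δ := by rw [le_div_iff₀ hδ]; linarith
    simp only [hχ]
    rw [Real.smoothTransition.one_of_one_le (by linarith),
      Real.smoothTransition.one_of_one_le (by linarith)]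
    ring
  have h := hu.integral_wave_operator hT htest
  have e1 : ∫ z in strip a T, clampExt a T u z * (dt (dt χ) z - dx (dx χ) z)
      = ∫ z in strip a T, clampExt a T u z * (dt (dt φ) z - dx (dx φ) z) := by
    refine setIntegral_congr_fun (measurableSet_strip a T) fun z hz => ?_
    have hz' := heq z (le_of_lt hz.1) hz.2.1.le
    simp only [(dt_eventuallyEq (dt_eventuallyEq hz')).eq_of_nhds,
      (dx_eventuallyEq (dx_eventuallyEq hz')).eq_of_nhds]
  have e2 : ∫ t in Ioo 0 T, clampExt a T u (a, t) *
          (dx χ (a, t) + β * χ (a, t) - γ * dt χ (a, t))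
      = ∫ t in Ioo 0 T, clampExt a T u (a, t) *
          (dx φ (a, t) + β * φ (a, t) - γ * dt φ (a, t)) := by
    refine setIntegral_congr_fun measurableSet_Ioo fun t ht => ?_
    have hz' := heq (a, t) le_rfl ht.1.le
    simp only [(dt_eventuallyEq hz').eq_of_nhds, (dx_eventuallyEq hz').eq_of_nhds,
      hz'.eq_of_nhds]
  have e3 : ∫ x in Iio a, f x * χ (x, 0) = ∫ x in Iio a, f x * φ (x, 0) := by
    refine setIntegral_congr_fun measurableSet_Iio fun x hx => ?_
    simp only [(heq (x, 0) (le_of_lt hx) le_rfl).eq_of_nhds]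
  rwa [e1, e2, e3] at h

end clampExt

/-! ### The trace at `x = a` -/

lemma contDiff_deriv {q : ℝ → ℝ} (hq : ContDiff ℝ ∞ q) : ContDiff ℝ ∞ (deriv q) :=
  hq.iterate_deriv 1

lemma ContDiff.hasDerivAt_deriv {q : ℝ → ℝ} (hq : ContDiff ℝ ∞ q) (s : ℝ) :
    HasDerivAt q (deriv q s) s :=
  (hq.differentiable (by simp) s).hasDerivAt

lemma dx_comp_add_sub {q : ℝ → ℝ} (hq : ContDiff ℝ ∞ q) (a : ℝ) :
    dx (fun z => q (z.2 + a - z.1)) = fun z => -deriv q (z.2 + a - z.1) := by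
  ext z
  have h := (ContDiff.hasDerivAt_deriv hq (z.2 + a - z.1)).comp z.1
    ((hasDerivAt_id z.1).const_sub (z.2 + a))
  refine h.deriv.trans (by ring)

lemma dt_comp_add_sub {q : ℝ → ℝ} (hq : ContDiff ℝ ∞ q) (a : ℝ) :
    dt (fun z => q (z.2 + a - z.1)) = fun z => deriv q (z.2 + a - z.1) := by
  ext z
  have h := (ContDiff.hasDerivAt_deriv hq (z.2 + a - z.1)).comp z.2
    (((hasDerivAt_id z.2).add_const a).sub_const z.1)
  refine h.deriv.trans (by ring)

section

variable {a b T γ β : ℝ} {f : ℝ → ℝ} {u : ℝ × ℝ → ℝ}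

/-- The trace of `u` at `x = a` satisfies `(1 + γ) U' + β U = f (a - ·)` in the weak sense. -/
lemma IsWeakSolution.trace_ode (hu : IsWeakSolution a T γ β f u) (hT : 0 < T)
    {q : ℝ → ℝ} (hq : ContDiff ℝ ∞ q) {T' : ℝ} (hT' : T' < T) (hq0 : ∀ s > T', q s = 0) :
    ∫ t in Ioo 0 T, clampExt a T u (a, t) * (β * q t - (1 + γ) * deriv q t)
      = ∫ x in Iio a, f x * q (a - x) := by
  have hφ : ContDiff ℝ ∞ (fun z : ℝ × ℝ => q (z.2 + a - z.1)) := hq.comp (by fun_prop)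
  -- On the support `t + a - x ≤ T'`. With `x ≤ a + δ` this bounds `t` by `T' + δ = (T + T') / 2 <
  -- T`; with `t ≥ -1` it bounds `x` below by `a - 1 - T'`.
  have h := hu.integral_wave_operator' hT hφ (R := -1 + a - T') (T' := (T + T') / 2)
    (δ := (T - T') / 2) (by linarith) (by linarith) fun x hx t ht hne => by
      have : t + a - x ≤ T' := by
        by_contra hc
        exact hne (hq0 _ (not_le.1 hc))
      constructor <;> linarith
  have hdx := dx_comp_add_sub hq a
  have hdt := dt_comp_add_sub hq a
  have hdd : ∀ z, dt (dt fun z => q (z.2 + a - z.1)) z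
      - dx (dx fun z => q (z.2 + a - z.1)) z = 0 := by
    intro z
    rw [hdx, hdt, dt_comp_add_sub (contDiff_deriv hq)]
    have h := (ContDiff.hasDerivAt_deriv (contDiff_deriv hq) (z.2 + a - z.1)).comp z.1
      ((hasDerivAt_id z.1).const_sub (z.2 + a))
    have h' : dx (fun z => -deriv q (z.2 + a - z.1)) z = deriv (deriv q) (z.2 + a - z.1) :=
      h.neg.deriv.trans (by ring)
    rw [h', sub_self]
  simp only [hdd, mul_zero, integral_zero, zero_add] at h
  simp only [hdx, hdt, add_sub_cancel_right] at h
  convert h using 4 with t x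
  all_goals ring_nf

/-- The two-sided Laplace transform `∫ e^{τ y} f(y) dy`. -/
noncomputable def laplace (f : ℝ → ℝ) (τ : ℝ) : ℝ := ∫ y, Real.exp (τ * y) * f y

lemma integrable_exp_mul (hf : Integrable f) (hfb : ∀ᵐ x : ℝ, b < x → f x = 0) {τ : ℝ}
    (hτ : 0 ≤ τ) : Integrable fun y => Real.exp (τ * y) * f y := by
  refine (hf.norm.const_mul (Real.exp (τ * b))).mono' ?_ ?_
  · exact (Continuous.aestronglyMeasurable (by fun_prop)).mul hf.aestronglyMeasurable
  · filter_upwards [hfb] with y hy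
    by_cases h : b < y
    · simp [hy h]
    · rw [norm_mul, Real.norm_eq_abs, Real.abs_exp]
      push Not at h
      gcongr

lemma abs_laplace_le (hf : Integrable f) (hfb : ∀ᵐ x : ℝ, b < x → f x = 0) {τ : ℝ}
    (hτ : 0 ≤ τ) : |laplace f τ| ≤ Real.exp (τ * b) * ∫ y, |f y| := by
  rw [laplace, ← integral_const_mul, ← Real.norm_eq_abs]
  refine norm_integral_le_of_norm_le (hf.abs.const_mul _) ?_
  filter_upwards [hfb] with y hy
  by_cases h : b < y
  · simp [hy h]
  · rw [norm_mul, Real.norm_eq_abs, Real.abs_exp, Real.norm_eq_abs]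
    push Not at h
    gcongr

/-- Take `q(t) = e^{-τ t} η(t)` in the trace equation, with `η = 1` up to time `S` and `η = 0` near
`T`. Up to `S` the factor `β q - (1 + γ) q'` is exactly `((1 + γ) τ + β) e^{-τ t}`; all that the
cutoff disturbs carries a factor at most `e^{-τ S}`, times `τ` from differentiating `q`. -/
lemma IsWeakSolution.laplace_trace (hu : IsWeakSolution a T γ β f u) (hf : Integrable f)
    (hfb : ∀ᵐ x : ℝ, b < x → f x = 0) (hba : b < a) {S : ℝ} (hS : 0 < S) (hST : S < T) :
    ∃ C, ∀ τ ≥ 1, |((1 + γ) * τ + β) * (∫ t in Ioc 0 S, Real.exp (-τ * t) * clampExt a T u (a, t))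
      - Real.exp (-τ * a) * laplace f τ| ≤ C * τ * Real.exp (-τ * S) := by
  have hT : 0 < T := hS.trans hST
  have hU : Continuous fun t => clampExt a T u (a, t) :=
    (continuous_clampExt hT.le hu.continuousOn).comp (by fun_prop)
  obtain ⟨M, hM⟩ := isCompact_Icc.exists_bound_of_continuousOn (hU.continuousOn (s := Icc 0 T))
  have hM0 : 0 ≤ M := (norm_nonneg _).trans (hM 0 ⟨le_rfl, hT.le⟩)
  -- a smooth cutoff
  set S' := (S + T) / 2 with hS'
  set η : ℝ → ℝ := fun t => Real.smoothTransition ((S' - t) / (S' - S)) with hη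
  have hSS' : 0 < S' - S := by rw [hS']; linarith
  have hηc : ContDiff ℝ ∞ η := contDiff_smoothTransition.comp (by fun_prop)
  have hη1 : ∀ t ≤ S, η t = 1 := fun t ht =>
    Real.smoothTransition.one_of_one_le (by rw [le_div_iff₀ hSS']; linarith)
  have hη0 : ∀ t > S', η t = 0 := fun t ht =>
    Real.smoothTransition.zero_of_nonpos (div_nonpos_of_nonpos_of_nonneg (by linarith) hSS'.le)
  have hηabs : ∀ t, |η t| ≤ 1 := fun t => abs_smoothTransition_le_one _
  obtain ⟨K, hK⟩ := isCompact_Icc.exists_bound_of_continuousOn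
    ((contDiff_deriv hηc).continuous.continuousOn (s := Icc 0 T))
  have hK0 : 0 ≤ K := (norm_nonneg _).trans (hK 0 ⟨le_rfl, hT.le⟩)
  simp only [Real.norm_eq_abs] at hM hK
  set L := ∫ y, |f y| with hL
  have hL0 : 0 ≤ L := integral_nonneg fun _ => abs_nonneg _
  refine ⟨M * (|β| + |1 + γ| * (1 + K)) * T + L, fun τ hτ => ?_⟩
  have hτ0 : 0 < τ := by linarith
  set q : ℝ → ℝ := fun t => Real.exp (-τ * t) * η t with hqdef
  have hqc : ContDiff ℝ ∞ q := (Real.contDiff_exp.comp (by fun_prop)).mul hηc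
  have hq' : ∀ t, deriv q t = Real.exp (-τ * t) * (-τ * η t + deriv η t) := by
    intro t
    have h1 : HasDerivAt (fun t : ℝ => Real.exp (-τ * t)) (Real.exp (-τ * t) * (-τ * 1)) t :=
      ((hasDerivAt_id t).const_mul (-τ)).exp
    refine (h1.mul (ContDiff.hasDerivAt_deriv hηc t)).deriv.trans (by ring)
  have key := hu.trace_ode hT hqc (T' := S') (by rw [hS']; linarith)
    fun s hs => by simp [hqdef, hη0 s hs]
  -- the left-hand side
  set g : ℝ → ℝ := fun t => clampExt a T u (a, t) * (β * q t - (1 + γ) * deriv q t) with hg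
  have hgc : Continuous g :=
    hU.mul ((continuous_const.mul hqc.continuous).sub
      (continuous_const.mul (contDiff_deriv hqc).continuous))
  have hgi : ∀ x y, IntegrableOn g (Ioc x y) := fun x y =>
    (hgc.integrableOn_Icc).mono_set Ioc_subset_Icc_self
  have hsplit : ∫ t in Ioo 0 T, g t = (∫ t in Ioc 0 S, g t) + ∫ t in Ioc S T, g t := by
    rw [← integral_Ioc_eq_integral_Ioo, ← Ioc_union_Ioc_eq_Ioc hS.le hST.le]
    exact setIntegral_union (Ioc_disjoint_Ioc_of_le le_rfl) measurableSet_Ioc (hgi _ _) (hgi _ _)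
  have hleft : ∫ t in Ioc 0 S, g t = ((1 + γ) * τ + β) *
      ∫ t in Ioc 0 S, Real.exp (-τ * t) * clampExt a T u (a, t) := by
    rw [← integral_const_mul, integral_Ioc_eq_integral_Ioo, integral_Ioc_eq_integral_Ioo]
    refine setIntegral_congr_fun measurableSet_Ioo fun t ht => ?_
    have hd : deriv η t = 0 := by
      have : η =ᶠ[𝓝 t] fun _ => 1 := by
        filter_upwards [Iio_mem_nhds ht.2] with y hy using hη1 y (le_of_lt hy)
      rw [this.deriv_eq]; simp
    simp only [hg, hq', hd]
    simp only [hqdef, hη1 t ht.2.le]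
    ring
  have hright : |∫ t in Ioc S T, g t| ≤ M * (|β| + |1 + γ| * (1 + K)) * T * τ
      * Real.exp (-τ * S) := by
    have : ∀ t ∈ Ioc S T, ‖g t‖ ≤ M * (|β| + |1 + γ| * (1 + K)) * τ * Real.exp (-τ * S) := by
      intro t ht
      have ht' : t ∈ Icc 0 T := ⟨(hS.trans ht.1).le, ht.2⟩
      have hexp : Real.exp (-τ * t) ≤ Real.exp (-τ * S) :=
        Real.exp_le_exp.2 (by nlinarith [ht.1])
      have hqa : |q t| ≤ τ * Real.exp (-τ * S) := by
        rw [hqdef]; simp only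
        rw [abs_mul, Real.abs_exp]
        calc Real.exp (-τ * t) * |η t| ≤ Real.exp (-τ * S) * 1 := by
              gcongr; exact hηabs t
          _ ≤ τ * Real.exp (-τ * S) := by nlinarith [Real.exp_pos (-τ * S)]
      have hqd : |deriv q t| ≤ (1 + K) * (τ * Real.exp (-τ * S)) := by
        rw [hq', abs_mul, Real.abs_exp]
        have : |-τ * η t + deriv η t| ≤ (1 + K) * τ := by
          calc |-τ * η t + deriv η t| ≤ |-τ * η t| + |deriv η t| := abs_add_le _ _
            _ ≤ τ * 1 + K := by
              rw [abs_mul, abs_neg, abs_of_pos hτ0]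
              gcongr
              · exact hηabs t
              · exact hK t ht'
            _ ≤ (1 + K) * τ := by nlinarith
        calc _ ≤ Real.exp (-τ * S) * ((1 + K) * τ) := by gcongr
          _ = _ := by ring
      rw [Real.norm_eq_abs, hg]; simp only
      rw [abs_mul]
      calc |clampExt a T u (a, t)| * |β * q t - (1 + γ) * deriv q t|
          ≤ M * (|β| * (τ * Real.exp (-τ * S))
            + |1 + γ| * ((1 + K) * (τ * Real.exp (-τ * S)))) := by
            refine mul_le_mul (hM t ht') ?_ (abs_nonneg _) hM0
            refine (abs_sub _ _).trans ?_
            rw [abs_mul β, abs_mul (1 + γ)]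
            exact add_le_add (mul_le_mul_of_nonneg_left hqa (abs_nonneg _))
              (mul_le_mul_of_nonneg_left hqd (abs_nonneg _))
        _ = _ := by ring
    have h2 := norm_setIntegral_le_of_norm_le_const (μ := volume) (s := Ioc S T) (by simp) this
    rw [Real.norm_eq_abs] at h2
    refine h2.trans ?_
    have hvol : volume.real (Ioc S T) ≤ T := by
      rw [Real.volume_real_Ioc_of_le hST.le]; linarith
    calc _ ≤ M * (|β| + |1 + γ| * (1 + K)) * τ * Real.exp (-τ * S) * T := by gcongr
      _ = _ := by ring
  -- the right-hand side
  have hrhs : |Real.exp (-τ * a) * laplace f τ - ∫ x in Iio a, f x * q (a - x)|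
      ≤ L * Real.exp (-τ * S) := by
    have e1 : ∫ x in Iio a, f x * q (a - x) = ∫ x, f x * q (a - x) := by
      refine setIntegral_eq_integral_of_ae_compl_eq_zero ?_
      filter_upwards [hfb] with x hx hxa
      rw [hx (by simp at hxa; linarith), zero_mul]
    have i1 : Integrable fun x => Real.exp (-τ * a) * (Real.exp (τ * x) * f x) :=
      (integrable_exp_mul hf hfb hτ0.le).const_mul _
    have e2 : ∀ x, f x * q (a - x) = Real.exp (-τ * a) * (Real.exp (τ * x) * f x) * η (a - x) := by
      intro x
      simp only [hqdef]
      rw [show -τ * (a - x) = -τ * a + τ * x by ring, Real.exp_add]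
      ring
    have i2 : Integrable fun x => f x * q (a - x) := by
      simp only [e2]
      refine i1.mul_bdd (c := 1) (hηc.continuous.comp (by fun_prop)).aestronglyMeasurable ?_
      exact ae_of_all _ fun x => hηabs _
    rw [e1, laplace, ← integral_const_mul, ← integral_sub i1 i2, mul_comm L, ← integral_const_mul,
      ← Real.norm_eq_abs]
    refine norm_integral_le_of_norm_le (hf.abs.const_mul _) (ae_of_all _ fun x => ?_)
    rw [e2, ← mul_one_sub, norm_mul, ← mul_assoc, ← Real.exp_add, norm_mul, Real.norm_eq_abs,
      Real.abs_exp, Real.norm_eq_abs, Real.norm_eq_abs]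
    -- Where the cutoff differs from `1`, the point `x` is at distance more than `S` from `a`, so
    -- the exponential itself is below `e^{-τ S}`.
    rcases le_or_gt (a - x) S with h | h
    · rw [hη1 _ h]
      simp; positivity
    · have h1 : |1 - η (a - x)| ≤ 1 := by
        have h2 : 0 ≤ η (a - x) := Real.smoothTransition.nonneg _
        have h3 : η (a - x) ≤ 1 := Real.smoothTransition.le_one _
        rw [abs_le]; constructor <;> linarith
      have h4 : Real.exp (-τ * a + τ * x) ≤ Real.exp (-τ * S) :=
        Real.exp_le_exp.2 (by nlinarith)
      calc _ ≤ Real.exp (-τ * S) * |f x| * 1 := by gcongr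
        _ = _ := mul_one _
  rw [hsplit, hleft] at key
  calc _ = |(-∫ t in Ioc S T, g t)
        - (Real.exp (-τ * a) * laplace f τ - ∫ x in Iio a, f x * q (a - x))| := by
        rw [← key]; congr 1; ring
    _ ≤ |∫ t in Ioc S T, g t| + |Real.exp (-τ * a) * laplace f τ - ∫ x in Iio a, f x * q (a - x)| := by
        rw [← abs_neg (∫ t in Ioc S T, g t)]; exact abs_sub _ _
    _ ≤ M * (|β| + |1 + γ| * (1 + K)) * T * τ * Real.exp (-τ * S) + L * Real.exp (-τ * S) :=
        add_le_add hright hrhs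
    _ ≤ _ := by
        have : L * Real.exp (-τ * S) ≤ L * Real.exp (-τ * S) * τ :=
          le_mul_of_one_le_right (by positivity) hτ
        linarith

end

/-! ### Propagation along characteristics -/

section

variable {p q : ℝ → ℝ}

lemma hasDerivAt_char_fst (hp : ContDiff ℝ ∞ p) (hq : ContDiff ℝ ∞ q) (z : ℝ × ℝ) :
    HasDerivAt (fun x => p (x + z.2) * q (x - z.2))
      (deriv p (z.1 + z.2) * q (z.1 - z.2) + p (z.1 + z.2) * deriv q (z.1 - z.2)) z.1 := by
  have h1 := (ContDiff.hasDerivAt_deriv hp (z.1 + z.2)).comp z.1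
    ((hasDerivAt_id z.1).add_const z.2)
  have h2 := (ContDiff.hasDerivAt_deriv hq (z.1 - z.2)).comp z.1
    ((hasDerivAt_id z.1).sub_const z.2)
  refine (h1.mul h2).congr_deriv (by simp)

lemma hasDerivAt_char_snd (hp : ContDiff ℝ ∞ p) (hq : ContDiff ℝ ∞ q) (z : ℝ × ℝ) :
    HasDerivAt (fun t => p (z.1 + t) * q (z.1 - t))
      (deriv p (z.1 + z.2) * q (z.1 - z.2) - p (z.1 + z.2) * deriv q (z.1 - z.2)) z.2 := by
  have h1 := (ContDiff.hasDerivAt_deriv hp (z.1 + z.2)).comp z.2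
    ((hasDerivAt_id z.2).const_add z.1)
  have h2 := (ContDiff.hasDerivAt_deriv hq (z.1 - z.2)).comp z.2
    ((hasDerivAt_id z.2).const_sub z.1)
  refine (h1.mul h2).congr_deriv ?_
  simp only [Function.comp]
  ring

/-- In the coordinates `ξ = x + t`, `η = x - t` the operator `∂ₜ² - ∂ₓ²` is `-4 ∂_ξ ∂_η`. -/
lemma wave_operator_char (hp : ContDiff ℝ ∞ p) (hq : ContDiff ℝ ∞ q) (z : ℝ × ℝ) :
    dt (dt fun z => p (z.1 + z.2) * q (z.1 - z.2)) z
      - dx (dx fun z => p (z.1 + z.2) * q (z.1 - z.2)) z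
      = -4 * (deriv p (z.1 + z.2) * deriv q (z.1 - z.2)) := by
  have h1 : (dx fun z : ℝ × ℝ => p (z.1 + z.2) * q (z.1 - z.2)) = fun z =>
      deriv p (z.1 + z.2) * q (z.1 - z.2) + p (z.1 + z.2) * deriv q (z.1 - z.2) :=
    funext fun z => (hasDerivAt_char_fst hp hq z).deriv
  have h2 : (dt fun z : ℝ × ℝ => p (z.1 + z.2) * q (z.1 - z.2)) = fun z =>
      deriv p (z.1 + z.2) * q (z.1 - z.2) - p (z.1 + z.2) * deriv q (z.1 - z.2) :=
    funext fun z => (hasDerivAt_char_snd hp hq z).deriv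
  have h3 := ((hasDerivAt_char_fst (contDiff_deriv hp) hq z).add
    (hasDerivAt_char_fst hp (contDiff_deriv hq) z)).deriv
  have h4 := ((hasDerivAt_char_snd (contDiff_deriv hp) hq z).sub
    (hasDerivAt_char_snd hp (contDiff_deriv hq) z)).deriv
  rw [h1, h2]
  refine (congrArg₂ (· - ·) h4 h3).trans ?_
  ring

end

/-- A smooth bump in characteristic coordinates. -/
noncomputable def charBump (z : ℝ × ℝ) : ℝ :=
  deriv Real.smoothTransition (z.1 + z.2) * deriv Real.smoothTransition (z.1 - z.2)

lemma continuous_charBump : Continuous charBump := by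
  have := contDiff_deriv_smoothTransition.continuous
  exact (this.comp (by fun_prop)).mul (this.comp (by fun_prop))

lemma charBump_support {z : ℝ × ℝ} (hz : charBump z ≠ 0) :
    z.1 ∈ Icc (0 : ℝ) 1 ∧ z.2 ∈ Icc (-(1 / 2) : ℝ) (1 / 2) := by
  rw [charBump, mul_ne_zero_iff] at hz
  have h1 := not_imp_comm.1 deriv_smoothTransition_eq_zero hz.1
  have h2 := not_imp_comm.1 deriv_smoothTransition_eq_zero hz.2
  simp only [mem_Icc] at *
  refine ⟨⟨?_, ?_⟩, ?_, ?_⟩ <;> linarith [h1.1, h1.2, h2.1, h2.2]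

lemma hasCompactSupport_charBump : HasCompactSupport charBump :=
  HasCompactSupport.intro (K := Icc (0 : ℝ) 1 ×ˢ Icc (-(1 / 2) : ℝ) (1 / 2))
    (isCompact_Icc.prod isCompact_Icc) fun _ hz => by
      by_contra h
      exact hz (charBump_support h)

/-- The value is the Jacobian of `(x, t) ↦ (x + t, x - t)`. The shear `(x, t) ↦ (x, x + t)`
preserves measure, and the remaining factor `k(2x - y)` contributes the `1 / 2`. -/
lemma integral_charBump : ∫ z, charBump z = 1 / 2 := by
  set k := deriv Real.smoothTransition with hk
  have hkc : Continuous k := contDiff_deriv_smoothTransition.continuous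
  have hmp : MeasurePreserving (fun z : ℝ × ℝ => (z.1, z.1 + z.2)) :=
    measurePreserving_prod_add volume volume
  have h1 : ∫ z, charBump z = ∫ z : ℝ × ℝ, k z.2 * k (2 * z.1 - z.2) := by
    have := hmp.integral_comp (MeasurableEquiv.shearAddRight ℝ).measurableEmbedding
      (fun z : ℝ × ℝ => k z.2 * k (2 * z.1 - z.2))
    rw [← this]
    refine integral_congr_ae (ae_of_all _ fun z => ?_)
    simp only [charBump, ← hk]
    congr 2; ring
  have h2 : Integrable (fun z : ℝ × ℝ => k z.2 * k (2 * z.1 - z.2)) := by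
    refine Continuous.integrable_of_hasCompactSupport (by fun_prop) ?_
    refine HasCompactSupport.intro (K := Icc (0 : ℝ) 1 ×ˢ Icc (0 : ℝ) 1)
      (isCompact_Icc.prod isCompact_Icc) fun z hz => ?_
    by_contra h
    rw [← ne_eq, mul_ne_zero_iff] at h
    have h1 := not_imp_comm.1 deriv_smoothTransition_eq_zero h.1
    have h2 := not_imp_comm.1 deriv_smoothTransition_eq_zero h.2
    refine hz ⟨⟨?_, ?_⟩, h1⟩ <;> linarith [h1.1, h1.2, h2.1, h2.2]
  rw [h1, Measure.volume_eq_prod, integral_prod_symm _ (by rwa [← Measure.volume_eq_prod])]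
  have h3 : ∀ y : ℝ, ∫ x, k y * k (2 * x - y) = k y * (1 / 2) := by
    intro y
    rw [integral_const_mul, Measure.integral_comp_mul_left (fun x => k (x - y)) 2,
      integral_sub_right_eq_self k, hk, integral_deriv_smoothTransition]
    norm_num
  simp only [h3]
  rw [integral_mul_const, hk, integral_deriv_smoothTransition, one_mul]

lemma tendsto_integral_charBump {G : ℝ × ℝ → ℝ} (hG : Continuous G) (z₀ : ℝ × ℝ) :
    Tendsto (fun n : ℕ => ∫ z, G z * ((n : ℝ) ^ 2 * charBump ((n : ℝ) • (z - z₀)))) atTop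
      (𝓝 (G z₀ * (1 / 2))) := by
  have hi : Integrable charBump :=
    continuous_charBump.integrable_of_hasCompactSupport hasCompactSupport_charBump
  obtain ⟨C, hC⟩ := (isCompact_closedBall z₀ 1).exists_bound_of_continuousOn hG.continuousOn
  have key : ∀ n : ℕ, 1 ≤ n → ∫ z, G z * ((n : ℝ) ^ 2 * charBump ((n : ℝ) • (z - z₀)))
      = ∫ z, G (z₀ + (n : ℝ)⁻¹ • z) * charBump z := by
    intro n hn
    have hn0 : (n : ℝ) ≠ 0 := by positivity
    have h1 := integral_sub_right_eq_self (μ := volume)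
      (fun z => G (z₀ + z) * ((n : ℝ) ^ 2 * charBump ((n : ℝ) • z))) z₀
    simp only [add_sub_cancel] at h1
    rw [h1]
    have h2 := Measure.integral_comp_smul (μ := (volume : Measure (ℝ × ℝ)))
      (fun z => G (z₀ + (n : ℝ)⁻¹ • z) * ((n : ℝ) ^ 2 * charBump z)) (n : ℝ)
    simp only [inv_smul_smul₀ hn0] at h2
    rw [h2, smul_eq_mul, ← integral_const_mul]
    refine integral_congr_ae (ae_of_all _ fun z => ?_)
    simp only [Module.finrank_prod, Module.finrank_self]
    rw [abs_of_nonneg (by positivity)]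
    field_simp
  rw [← integral_charBump, ← integral_const_mul]
  refine Tendsto.congr' (f₁ := fun n : ℕ => ∫ z, G (z₀ + (n : ℝ)⁻¹ • z) * charBump z) ?_ ?_
  · filter_upwards [eventually_ge_atTop 1] with n hn using (key n hn).symm
  refine tendsto_integral_filter_of_dominated_convergence (fun z => C * |charBump z|) ?_ ?_
    (hi.abs.const_mul C) ?_
  · refine Eventually.of_forall fun n => ?_
    exact ((hG.comp (by fun_prop)).mul continuous_charBump).aestronglyMeasurable
  · filter_upwards [eventually_ge_atTop 1] with n hn
    refine ae_of_all _ fun z => ?_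
    by_cases hz : charBump z = 0
    · simp [hz]
    · rw [norm_mul]
      refine mul_le_mul_of_nonneg_right (hC _ ?_) (abs_nonneg _)
      have hz' := charBump_support hz
      rw [mem_closedBall_iff_norm, add_sub_cancel_left, norm_smul, norm_inv]
      have h1 : ‖z‖ ≤ 1 := by
        rw [Prod.norm_def, max_le_iff, Real.norm_eq_abs, Real.norm_eq_abs, abs_le, abs_le]
        obtain ⟨⟨_, _⟩, _, _⟩ := hz'
        refine ⟨⟨?_, ?_⟩, ?_, ?_⟩ <;> linarith
      have h2 : ‖(n : ℝ)‖⁻¹ ≤ 1 := by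
        rw [Real.norm_natCast]
        exact inv_le_one_of_one_le₀ (by exact_mod_cast hn)
      exact mul_le_one₀ h2 (norm_nonneg _) h1
  · refine ae_of_all _ fun z => Tendsto.mul_const _ ?_
    refine (hG.tendsto z₀).comp ?_
    have := (tendsto_inv_atTop_nhds_zero_nat (𝕜 := ℝ)).smul_const z
    simpa using this.const_add z₀

section

variable {a b T γ β : ℝ} {f : ℝ → ℝ} {u : ℝ × ℝ → ℝ}

/-- The bump may stick out of the strip below `t = 0`, but the extension of `u` vanishes there;
hence no lower bound on `t₀` is needed. -/
lemma setIntegral_strip_charBump (h0 : ∀ x ≤ a, u (x, 0) = 0) {x₀ t₀ : ℝ} {n : ℕ}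
    (hx : x₀ + 1 / n < a) (ht : t₀ + 1 / n < T) (hn : 0 < n) :
    ∫ z in strip a T, clampExt a T u z * ((n : ℝ) ^ 2 * charBump ((n : ℝ) • (z - (x₀, t₀))))
      = ∫ z, clampExt a T u z * ((n : ℝ) ^ 2 * charBump ((n : ℝ) • (z - (x₀, t₀)))) := by
  have hn' : (0 : ℝ) < n := by exact_mod_cast hn
  refine setIntegral_eq_integral_of_forall_compl_eq_zero fun z hz => ?_
  by_contra hne
  rw [← ne_eq, mul_ne_zero_iff, mul_ne_zero_iff] at hne
  obtain ⟨⟨-, h2⟩, -, h4⟩ := charBump_support hne.2.2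
  simp only [Prod.smul_fst, Prod.fst_sub, Prod.smul_snd, Prod.snd_sub, smul_eq_mul] at h2 h4
  rw [mul_comm, ← le_div_iff₀ hn'] at h2 h4
  have h5 : 1 / 2 / (n : ℝ) ≤ 1 / n := by gcongr; norm_num
  refine hz ⟨show z.1 < a by linarith, ?_, by linarith⟩
  by_contra hc
  exact hne.1 (clampExt_of_nonpos h0 (not_lt.1 hc))

/-- The difference of `u` along a characteristic `x + t = const`. -/
lemma IsWeakSolution.sub_eq_integral (hu : IsWeakSolution a T γ β f u) (hT : 0 < T)
    (hf : Integrable f) (hfb : ∀ᵐ x : ℝ, b < x → f x = 0) (hba : b < a)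
    {x₀ t₀ x₁ t₁ : ℝ} (hx : x₀ ≤ x₁) (hx₁ : x₁ < a) (ht₀ : t₀ < T)
    (hξ : x₀ + t₀ = x₁ + t₁) (hb : b ≤ x₀ + t₀) :
    clampExt a T u (x₀, t₀) - clampExt a T u (x₁, t₁)
      = 1 / 2 * ∫ y in (x₀ - t₀)..(x₁ - t₁), f y := by
  have hη : x₀ - t₀ ≤ x₁ - t₁ := by linarith
  have hU := continuous_clampExt hT.le hu.continuousOn
  have l1 := ((tendsto_integral_charBump hU (x₀, t₀)).sub
    (tendsto_integral_charBump hU (x₁, t₁))).const_mul (-4)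
  -- the right-hand side
  set g : ℕ → ℝ → ℝ := fun n y => (Real.smoothTransition (n * (y - (x₀ + t₀))) - 1) *
    (Real.smoothTransition (n * (y - (x₀ - t₀))) - Real.smoothTransition (n * (y - (x₁ - t₁))))
    with hg
  have hst := contDiff_smoothTransition
  have l2 : Tendsto (fun n : ℕ => ∫ y in Iio a, f y * g n y) atTop
      (𝓝 (-∫ y in (x₀ - t₀)..(x₁ - t₁), f y)) := by
    set H : ℝ → ℝ := (Ioi (0 : ℝ)).indicator fun _ => 1 with hH
    have e : -∫ y in (x₀ - t₀)..(x₁ - t₁), f y = ∫ y in Iio a, f y *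
        ((H (y - (x₀ + t₀)) - 1) * (H (y - (x₀ - t₀)) - H (y - (x₁ - t₁)))) := by
      rw [intervalIntegral.integral_of_le hη, ← integral_indicator measurableSet_Ioc,
        ← integral_indicator measurableSet_Iio, ← integral_neg]
      refine integral_congr_ae ?_
      filter_upwards [hfb] with y hy
      by_cases h : b < y
      · rw [indicator, indicator]
        simp [hy h]
      · push Not at h
        have e1 : H (y - (x₀ + t₀)) = 0 := by
          rw [hH, indicator_of_notMem]; simp only [mem_Ioi, not_lt]; linarith
        rw [indicator_of_mem (show y ∈ Iio a from lt_of_le_of_lt h hba), e1]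
        simp only [hH, indicator, mem_Ioi, mem_Ioc, sub_pos]
        by_cases c1 : x₀ - t₀ < y <;> by_cases c2 : x₁ - t₁ < y
        · simp [c1, c2]
        · simp [c1, c2, not_lt.1 c2]
        · exact absurd (lt_of_le_of_lt hη c2) c1
        · simp [c1, c2]
    rw [e]
    refine tendsto_integral_of_dominated_convergence (fun y => |f y| * 2) ?_
      (hf.abs.mul_const 2).integrableOn ?_ ?_
    · intro n
      refine hf.aestronglyMeasurable.restrict.mul (Continuous.aestronglyMeasurable ?_)
      exact ((hst.continuous.comp (by fun_prop)).sub continuous_const).mul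
        ((hst.continuous.comp (by fun_prop)).sub (hst.continuous.comp (by fun_prop)))
    · refine fun n => ae_of_all _ fun y => ?_
      rw [norm_mul]
      refine mul_le_mul_of_nonneg_left ?_ (abs_nonneg _)
      have k0 := Real.smoothTransition.nonneg
      have k1 := Real.smoothTransition.le_one
      rw [hg]; simp only
      rw [norm_mul, Real.norm_eq_abs, Real.norm_eq_abs]
      have a1 : |Real.smoothTransition (n * (y - (x₀ + t₀))) - 1| ≤ 2 := by
        rw [abs_le]; constructor <;> linarith [k0 (n * (y - (x₀ + t₀))), k1 (n * (y - (x₀ + t₀)))]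
      have a2 : |Real.smoothTransition (n * (y - (x₀ - t₀)))
          - Real.smoothTransition (n * (y - (x₁ - t₁)))| ≤ 1 := by
        rw [abs_le]
        constructor <;> linarith [k0 (n * (y - (x₀ - t₀))), k1 (n * (y - (x₀ - t₀))),
          k0 (n * (y - (x₁ - t₁))), k1 (n * (y - (x₁ - t₁)))]
      nlinarith [abs_nonneg (Real.smoothTransition (n * (y - (x₀ + t₀))) - 1)]
    · refine ae_of_all _ fun y => Tendsto.const_mul _ ?_
      exact ((tendsto_smoothTransition_mul _).sub_const 1).mul
        ((tendsto_smoothTransition_mul _).sub (tendsto_smoothTransition_mul _))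
  have hlim : Tendsto (fun n : ℕ => 1 / (n : ℝ)) atTop (𝓝 0) := tendsto_one_div_atTop_nhds_zero_nat
  have hev : ∀ᶠ n : ℕ in atTop, 1 / (n : ℝ) < min ((a - x₁) / 2) (T - t₀) :=
    hlim.eventually_lt_const (lt_min (by linarith) (by linarith))
  have heq := tendsto_nhds_unique l1 (l2.congr' ?_)
  · linarith
  filter_upwards [hev, eventually_gt_atTop 0] with n hnε hn
  rw [lt_min_iff] at hnε
  have hn' : (0 : ℝ) < n := by exact_mod_cast hn
  have hn1 : 0 < 1 / (n : ℝ) := by positivity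
  set p : ℝ → ℝ := fun s => Real.smoothTransition (n * (s - (x₀ + t₀))) - 1 with hp
  set q : ℝ → ℝ := fun s => Real.smoothTransition (n * (s - (x₀ - t₀)))
    - Real.smoothTransition (n * (s - (x₁ - t₁))) with hq
  have hpc : ContDiff ℝ ∞ p := (hst.comp (by fun_prop)).sub contDiff_const
  have hqc : ContDiff ℝ ∞ q := (hst.comp (by fun_prop)).sub (hst.comp (by fun_prop))
  have hscale : ∀ c s : ℝ, HasDerivAt (fun s => Real.smoothTransition (n * (s - c)))
      (n * deriv Real.smoothTransition (n * (s - c))) s := by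
    intro c s
    have := (hasDerivAt_smoothTransition (n * (s - c))).comp s
      (((hasDerivAt_id s).sub_const c).const_mul (n : ℝ))
    exact this.congr_deriv (by ring)
  have hp' : ∀ s, deriv p s = n * deriv Real.smoothTransition (n * (s - (x₀ + t₀))) :=
    fun s => ((hscale _ s).sub_const 1).deriv
  have hq' : ∀ s, deriv q s = n * deriv Real.smoothTransition (n * (s - (x₀ - t₀)))
      - n * deriv Real.smoothTransition (n * (s - (x₁ - t₁))) :=
    fun s => ((hscale _ s).sub (hscale _ s)).deriv
  -- Adding and subtracting the bounds on `x + t` and `x - t` keeps the support below time `T` and,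
  -- for large `n`, away from `x = a`.
  have hsupp : ∀ x t : ℝ, p (x + t) * q (x - t) ≠ 0 →
      x < x₁ + 1 / n ∧ t ≤ t₀ + 1 / n / 2 ∧ x₀ - t₀ + t ≤ x := by
    intro x t hne
    rw [mul_ne_zero_iff] at hne
    have s1 : x + t - (x₀ + t₀) < 1 / n := by
      by_contra hc
      push Not at hc
      rw [div_le_iff₀ hn'] at hc
      refine hne.1 ?_
      rw [hp]; simp only
      rw [Real.smoothTransition.one_of_one_le (by linarith), sub_self]
    have s2 : x₀ - t₀ < x - t := by
      by_contra hc
      push Not at hc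
      refine hne.2 ?_
      rw [hq]; simp only
      rw [Real.smoothTransition.zero_of_nonpos
          (mul_nonpos_of_nonneg_of_nonpos hn'.le (by linarith)),
        Real.smoothTransition.zero_of_nonpos
          (mul_nonpos_of_nonneg_of_nonpos hn'.le (by linarith)), sub_self]
    have s3 : x - t - (x₁ - t₁) < 1 / n := by
      by_contra hc
      push Not at hc
      have hc' : 1 / n ≤ x - t - (x₀ - t₀) := by linarith
      rw [div_le_iff₀ hn'] at hc hc'
      refine hne.2 ?_
      rw [hq]; simp only
      rw [Real.smoothTransition.one_of_one_le (by linarith),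
        Real.smoothTransition.one_of_one_le (by linarith), sub_self]
    refine ⟨by linarith, by linarith, by linarith⟩
  have hφc : ContDiff ℝ ∞ (fun z : ℝ × ℝ => p (z.1 + z.2) * q (z.1 - z.2)) :=
    (hpc.comp (by fun_prop)).mul (hqc.comp (by fun_prop))
  have hmain := hu.integral_wave_operator' hT hφc (R := x₀ - t₀ - 1) (T' := t₀ + 1 / n / 2)
    (δ := 1) (by linarith) one_pos fun x hx t ht hne => by
      have := hsupp x t hne
      exact ⟨by linarith [this.2.2], this.2.1⟩
  -- no contribution of the boundary `x = a`
  have hbd : ∀ t, (fun z : ℝ × ℝ => p (z.1 + z.2) * q (z.1 - z.2)) =ᶠ[𝓝 (a, t)] fun _ => 0 := by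
    intro t
    have : ∀ᶠ z : ℝ × ℝ in 𝓝 (a, t), x₁ + 1 / n < z.1 :=
      continuousAt_const.eventually_lt continuous_fst.continuousAt (by simp only; linarith [hnε.1])
    filter_upwards [this] with z hz
    by_contra hne
    exact lt_asymm hz (hsupp z.1 z.2 hne).1
  have hdx0 : ∀ z, dx (fun _ => (0 : ℝ)) z = 0 := fun z => by simp [dx]
  have hdt0 : ∀ z, dt (fun _ => (0 : ℝ)) z = 0 := fun z => by simp [dt]
  have hz1 : ∀ t, p (a + t) * q (a - t) = 0 := fun t => (hbd t).eq_of_nhds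
  simp only [(dx_eventuallyEq (hbd _)).eq_of_nhds, (dt_eventuallyEq (hbd _)).eq_of_nhds, hdx0,
    hdt0, hz1, wave_operator_char hpc hqc, add_zero, sub_zero, mul_zero, integral_zero] at hmain
  change ∫ y in Iio a, f y * (p y * q y) = _
  rw [← hmain, ← setIntegral_strip_charBump hu.initial (x₀ := x₀) (t₀ := t₀)
      (by linarith [hnε.1]) (by linarith [hnε.2]) hn,
    ← setIntegral_strip_charBump hu.initial (x₀ := x₁) (t₀ := t₁)
      (by linarith [hnε.1]) (by linarith [hnε.2]) hn]
  have hint : ∀ z₀ : ℝ × ℝ, Integrable fun z =>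
      clampExt a T u z * ((n : ℝ) ^ 2 * charBump ((n : ℝ) • (z - z₀))) := by
    intro z₀
    refine Continuous.integrable_of_hasCompactSupport (hU.mul (continuous_const.mul
      (continuous_charBump.comp (by fun_prop)))) ?_
    refine HasCompactSupport.mul_left (HasCompactSupport.mul_left ?_)
    have := hasCompactSupport_charBump.comp_homeomorph
      ((Homeomorph.subRight z₀).trans (Homeomorph.smulOfNeZero (n : ℝ) hn'.ne'))
    exact this
  rw [← integral_sub (hint _).integrableOn (hint _).integrableOn, ← integral_const_mul]
  refine integral_congr_ae (ae_of_all _ fun z => ?_)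
  simp only [hp', hq', charBump, Prod.smul_fst, Prod.fst_sub, Prod.smul_snd, Prod.snd_sub,
    smul_eq_mul]
  rw [show (n : ℝ) * (z.1 - x₀) + n * (z.2 - t₀) = n * (z.1 + z.2 - (x₀ + t₀)) by ring,
    show (n : ℝ) * (z.1 - x₀) - n * (z.2 - t₀) = n * (z.1 - z.2 - (x₀ - t₀)) by ring,
    show (n : ℝ) * (z.1 - x₁) + n * (z.2 - t₁) = n * (z.1 + z.2 - (x₀ + t₀)) by rw [hξ]; ring,
    show (n : ℝ) * (z.1 - x₁) - n * (z.2 - t₁) = n * (z.1 - z.2 - (x₁ - t₁)) by ring]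
  ring

end

/-! ### The d'Alembert representation near the observation point -/

section

variable {a b T γ β : ℝ} {f : ℝ → ℝ} {u : ℝ × ℝ → ℝ}

/-- The primitive of `f` that vanishes at `b`. -/
noncomputable def primitive (b : ℝ) (f : ℝ → ℝ) (s : ℝ) : ℝ := ∫ y in b..s, f y

lemma continuous_primitive (hf : Integrable f) (b : ℝ) : Continuous (primitive b f) :=
  intervalIntegral.continuous_primitive (fun _ _ => hf.intervalIntegrable) b

lemma primitive_of_le (hfb : ∀ᵐ x : ℝ, b < x → f x = 0) {s : ℝ} (hs : b ≤ s) :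
    primitive b f s = 0 := by
  refine intervalIntegral.integral_zero_ae ?_
  filter_upwards [hfb] with y hy hys
  rw [uIoc_of_le hs] at hys
  exact hy hys.1

/-- Writing the primitive as an integral over the whole line makes Fubini available for its Laplace
transform. -/
lemma primitive_eq_neg_integral (hfb : ∀ᵐ x : ℝ, b < x → f x = 0) (s : ℝ) :
    primitive b f s = -∫ y, (Ioi s).indicator f y := by
  rcases le_total b s with hs | hs
  · rw [primitive_of_le hfb hs, integral_eq_zero_of_ae, neg_zero]
    filter_upwards [hfb] with y hy
    by_cases h : s < y
    · rw [indicator_of_mem (by exact h), hy (lt_of_le_of_lt hs h)]; rfl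
    · rw [indicator_of_notMem (by simpa using h)]; rfl
  · rw [primitive, intervalIntegral.integral_symm, intervalIntegral.integral_of_le hs,
      ← integral_indicator measurableSet_Ioc]
    congr 1
    refine integral_congr_ae ?_
    filter_upwards [hfb] with y hy
    by_cases h1 : s < y <;> by_cases h2 : y ≤ b <;> simp_all [indicator]

/-- The profile of the part of `u` that travels in the direction of decreasing `x`. -/
noncomputable def reflected (a b T : ℝ) (f : ℝ → ℝ) (u : ℝ × ℝ → ℝ) (s : ℝ) : ℝ :=
  clampExt a T u (a, s - a) + 1 / 2 * primitive b f (2 * a - s)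

lemma IsWeakSolution.continuous_reflected (hu : IsWeakSolution a T γ β f u) (hT : 0 < T)
    (hf : Integrable f) : Continuous (reflected a b T f u) :=
  ((continuous_clampExt hT.le hu.continuousOn).comp (by fun_prop)).add
    (continuous_const.mul ((continuous_primitive hf b).comp (by fun_prop)))

/-- Follow the characteristic `x + t = const` up to the boundary: the identity for points with `x₁ <
a` passes to the limit `x₁ → a` by continuity. The condition `b < x` ensures `b ≤ x + t`. -/
lemma IsWeakSolution.eq_reflected_sub (hu : IsWeakSolution a T γ β f u) (hT : 0 < T)
    (hf : Integrable f) (hfb : ∀ᵐ x : ℝ, b < x → f x = 0) {x t : ℝ} (hbx : b < x)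
    (hxa : x < a) (ht : t ∈ Ioo 0 T) :
    u (x, t) = reflected a b T f u (x + t) + -(1 / 2) * primitive b f (x - t) := by
  have hU := continuous_clampExt hT.le hu.continuousOn
  have hF := continuous_primitive hf b
  have h1 : ∀ x₁ ∈ Ioo x a, u (x, t) = clampExt a T u (x₁, x + t - x₁)
      + 1 / 2 * (primitive b f (2 * x₁ - x - t) - primitive b f (x - t)) := by
    intro x₁ hx₁
    have h := hu.sub_eq_integral hT hf hfb (hbx.trans hxa) hx₁.1.le hx₁.2 ht.2
      (t₁ := x + t - x₁) (by ring) (by linarith [ht.1])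
    rw [clampExt_eq (z := (x, t)) hxa.le (Ioo_subset_Icc_self ht)] at h
    rw [primitive, primitive, intervalIntegral.integral_interval_sub_left hf.intervalIntegrable
      hf.intervalIntegrable, show 2 * x₁ - x - t = x₁ - (x + t - x₁) by ring, ← h]
    ring
  have h2 : Tendsto (fun x₁ => clampExt a T u (x₁, x + t - x₁)
      + 1 / 2 * (primitive b f (2 * x₁ - x - t) - primitive b f (x - t))) (𝓝[<] a)
      (𝓝 (clampExt a T u (a, x + t - a)
        + 1 / 2 * (primitive b f (2 * a - x - t) - primitive b f (x - t)))) := by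
    refine Tendsto.mono_left ?_ nhdsWithin_le_nhds
    refine Continuous.tendsto' ?_ _ _ rfl
    fun_prop
  have h3 : Tendsto (fun _ : ℝ => u (x, t)) (𝓝[<] a) (𝓝 (u (x, t))) := tendsto_const_nhds
  have h4 := tendsto_nhds_unique h3 (h2.congr' (by
    filter_upwards [Ioo_mem_nhdsLT hxa] with x₁ hx₁ using (h1 x₁ hx₁).symm))
  rw [h4, reflected, show 2 * a - (x + t) = 2 * a - x - t by ring]
  ring

end

/-! ### The functions `w` and `v` near the observation point -/

lemma hasDerivAt_integral_shift {g : ℝ → ℝ} (hg : Continuous g) (c d x : ℝ) :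
    HasDerivAt (fun x => ∫ s in (x + c)..(x + d), g s) (g (x + d) - g (x + c)) x := by
  have h : ∀ e, HasDerivAt (fun x => ∫ s in (0 : ℝ)..(x + e), g s) (g (x + e)) x := fun e => by
    have h1 := (hg.integral_hasStrictDerivAt 0 (x + e)).hasDerivAt.comp x
      ((hasDerivAt_id x).add_const e)
    exact h1.congr_deriv (mul_one _)
  refine ((h d).sub (h c)).congr_of_eventuallyEq (Eventually.of_forall fun y => ?_)
  exact (intervalIntegral.integral_interval_sub_left (hg.intervalIntegrable _ _)
    (hg.intervalIntegrable _ _)).symm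

/-- Substituting `s = x + t` and `s = x - t` moves the dependence on `x` into factors `e^{±τ x}` and
the limits of integration, so continuity of `P` and `Q` suffices. The `P` part grows like `e^{τ x}`
and the `Q` part like `e^{-τ x}`, so adding `τ w` doubles the former and cancels the latter. -/
lemma hasDerivAt_w {a b T : ℝ} {u : ℝ × ℝ → ℝ} {P Q : ℝ → ℝ} (hP : Continuous P)
    (hQ : Continuous Q) (hb : b < 0) (ha : 0 < a) (hT : 0 < T)
    (hu : ∀ x ∈ Ioo b a, ∀ t ∈ Ioo 0 T, u (x, t) = P (x + t) + Q (x - t)) (τ : ℝ) :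
    HasDerivAt (w T u τ) (-τ * w T u τ 0 + (2 * τ * (∫ s in (0 : ℝ)..T, Real.exp (-τ * s) * P s)
      + (Real.exp (-τ * T) * P T - P 0) + (Q 0 - Real.exp (-τ * T) * Q (-T)))) 0 := by
  set p : ℝ → ℝ := fun s => Real.exp (-τ * s) * P s with hp
  set q : ℝ → ℝ := fun s => Real.exp (τ * s) * Q s with hq
  have hpc : Continuous p := by fun_prop
  have hqc : Continuous q := by fun_prop
  have hw : ∀ x ∈ Ioo b a, w T u τ x = Real.exp (τ * x) * (∫ s in (x + 0)..(x + T), p s)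
      + Real.exp (-τ * x) * ∫ s in (x + -T)..(x + 0), q s := by
    intro x hx
    have e1 : w T u τ x = ∫ t in (0 : ℝ)..T, (Real.exp (τ * x) * p (x + t)
        + Real.exp (-τ * x) * q (x - t)) := by
      rw [w, intervalIntegral.integral_of_le hT.le, intervalIntegral.integral_of_le hT.le,
        integral_Ioc_eq_integral_Ioo, integral_Ioc_eq_integral_Ioo]
      refine setIntegral_congr_fun measurableSet_Ioo fun t ht => ?_
      simp only [hp, hq, hu x hx t ht]
      rw [← mul_assoc, ← mul_assoc, ← Real.exp_add, ← Real.exp_add, mul_add]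
      congr 3 <;> ring_nf
    rw [e1, intervalIntegral.integral_add, intervalIntegral.integral_const_mul,
      intervalIntegral.integral_const_mul, intervalIntegral.integral_comp_add_left,
      intervalIntegral.integral_comp_sub_left, sub_zero, add_zero, sub_eq_add_neg]
    · exact Continuous.intervalIntegrable (by fun_prop) _ _
    · exact Continuous.intervalIntegrable (by fun_prop) _ _
  have he : ∀ c : ℝ, HasDerivAt (fun x : ℝ => Real.exp (c * x)) c 0 := fun c => by
    simpa using ((hasDerivAt_id (0 : ℝ)).const_mul c).exp
  have hd := ((he τ).mul (hasDerivAt_integral_shift hpc 0 T 0)).add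
    ((he (-τ)).mul (hasDerivAt_integral_shift hqc (-T) 0 0))
  refine (hd.congr_of_eventuallyEq ?_).congr_deriv ?_
  · filter_upwards [Ioo_mem_nhds hb ha] with x hx using hw x hx
  · rw [hw 0 ⟨hb, ha⟩]
    simp only [hp, hq, zero_add, mul_zero, Real.exp_zero, one_mul, mul_neg, neg_mul, neg_zero]
    ring

section

variable {b : ℝ} {f : ℝ → ℝ}

lemma v_eq (hfb : ∀ᵐ x : ℝ, b < x → f x = 0) (τ : ℝ) {x : ℝ} (hx : b < x) :
    v f τ x = 1 / (2 * τ) * (Real.exp (-τ * x) * laplace f τ) := by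
  rw [v, laplace, ← integral_const_mul (Real.exp (-τ * x))]
  congr 1
  refine integral_congr_ae ?_
  filter_upwards [hfb] with y hy
  by_cases h : b < y
  · simp [hy h]
  · rw [abs_of_nonneg (by linarith), ← mul_assoc, ← Real.exp_add]
    congr 2; ring

lemma hasDerivAt_v (hfb : ∀ᵐ x : ℝ, b < x → f x = 0) (hb : b < 0) (τ : ℝ) :
    HasDerivAt (v f τ) (-τ * v f τ 0) 0 := by
  have he : HasDerivAt (fun x : ℝ => Real.exp (-τ * x)) (-τ) 0 := by
    simpa using ((hasDerivAt_id (0 : ℝ)).const_mul (-τ)).exp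
  refine (((he.mul_const (laplace f τ)).const_mul (1 / (2 * τ))).congr_of_eventuallyEq
    ?_).congr_deriv ?_
  · filter_upwards [Ioi_mem_nhds hb] with x hx using v_eq hfb τ hx
  · rw [v_eq hfb τ hb, mul_zero, Real.exp_zero]; ring

/-- The Laplace transform of a reflected primitive of `f`, up to an exponentially small error. -/
lemma abs_integral_primitive_add_le {a T : ℝ} (hf : Integrable f)
    (hfb : ∀ᵐ x : ℝ, b < x → f x = 0) (hba : b ≤ 2 * a) (hT : 0 ≤ T) (τ : ℝ) (hτ : 0 < τ) :
    |τ * (∫ s in (0 : ℝ)..T, Real.exp (-τ * s) * primitive b f (2 * a - s))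
      + Real.exp (-τ * (2 * a)) * laplace f τ| ≤ Real.exp (-τ * T) * ∫ y, |f y| := by
  set h : ℝ → ℝ := fun s => τ * Real.exp (-τ * s) with hh
  have hhc : Continuous h := by fun_prop
  have hhi : Integrable h (volume.restrict (Ioc 0 T)) :=
    (hhc.integrableOn_Icc (a := 0) (b := T)).mono_set Ioc_subset_Icc_self
  have hprod : Integrable (Function.uncurry fun s y => h s * (Ioi (2 * a - s)).indicator f y)
      ((volume.restrict (Ioc 0 T)).prod volume) := by
    have hm : MeasurableSet {z : ℝ × ℝ | 2 * a - z.1 < z.2} :=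
      measurableSet_lt (by fun_prop) (by fun_prop)
    refine ((hhi.mul_prod hf).indicator hm).congr (ae_of_all _ fun z => ?_)
    simp only [Function.uncurry, indicator, mem_ofPred_eq, mem_Ioi]
    split_ifs <;> simp
  have e1 : τ * (∫ s in (0 : ℝ)..T, Real.exp (-τ * s) * primitive b f (2 * a - s))
      = -∫ y, ∫ s in Ioc 0 T, h s * (Ioi (2 * a - s)).indicator f y := by
    rw [← integral_integral_swap hprod, intervalIntegral.integral_of_le hT, ← integral_const_mul,
      ← integral_neg]
    refine integral_congr_ae (ae_of_all _ fun s => ?_)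
    simp only [primitive_eq_neg_integral hfb, hh, integral_const_mul]
    ring
  have hprim : ∀ c ≤ T, ∫ s in Ioc c T, h s = Real.exp (-τ * c) - Real.exp (-τ * T) := by
    intro c hc
    rw [← intervalIntegral.integral_of_le hc]
    have hd : ∀ s ∈ uIcc c T, HasDerivAt (fun s => -Real.exp (-τ * s)) (h s) s := by
      intro s _
      have := ((hasDerivAt_id s).const_mul (-τ)).exp.neg
      refine this.congr_deriv ?_
      simp only [hh, id]; ring
    rw [intervalIntegral.integral_eq_sub_of_hasDerivAt hd (hhc.intervalIntegrable _ _)]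
    ring
  have hright : Integrable fun y => ∫ s in Ioc 0 T, h s * (Ioi (2 * a - s)).indicator f y :=
    hprod.integral_prod_right
  rw [e1, laplace, ← integral_const_mul, neg_add_eq_sub,
    ← integral_sub ((integrable_exp_mul hf hfb hτ.le).const_mul _) hright,
    ← integral_const_mul, ← Real.norm_eq_abs]
  refine norm_integral_le_of_norm_le (hf.abs.const_mul _) ?_
  filter_upwards [hfb] with y hy
  by_cases hby : b < y
  · have : ∀ s, (Ioi (2 * a - s)).indicator f y = 0 := fun s => by
      simp [indicator, hy hby]
    simp [this, hy hby]
  · push Not at hby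
    -- For fixed `y` the condition becomes `s > 2a - y`, so the inner integral is `e^{-τ (2a - y)} -
    -- e^{-τ T}`, or zero if `2a - y > T`; in both cases the discrepancy is at most `e^{-τ T}`.
    have e2 : ∀ s, h s * (Ioi (2 * a - s)).indicator f y
        = (Ioi (2 * a - y)).indicator h s * f y := by
      intro s
      simp only [indicator, mem_Ioi]
      by_cases c : 2 * a - s < y
      · rw [if_pos c, if_pos (by linarith)]
      · rw [if_neg c, if_neg (by intro h; exact c (by linarith))]; simp
    simp only [e2]
    rw [integral_mul_const, setIntegral_indicator measurableSet_Ioi, ← mul_assoc, ← sub_mul,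
      norm_mul, Real.norm_eq_abs, Real.norm_eq_abs, ← Real.exp_add]
    refine mul_le_mul_of_nonneg_right ?_ (abs_nonneg _)
    rw [show -τ * (2 * a) + τ * y = -τ * (2 * a - y) by ring]
    have e3 : Ioc 0 T ∩ Ioi (2 * a - y) = Ioc (2 * a - y) T := by
      ext s
      simp only [mem_inter_iff, mem_Ioc, mem_Ioi]
      constructor
      · rintro ⟨⟨_, h1⟩, h2⟩; exact ⟨h2, h1⟩
      · rintro ⟨h1, h2⟩; exact ⟨⟨by linarith, h2⟩, h1⟩
    rw [e3]
    rcases le_or_gt (2 * a - y) T with c | c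
    · rw [hprim _ c, sub_sub_cancel, Real.abs_exp]
    · rw [Ioc_eq_empty (by linarith), Measure.restrict_empty, integral_zero_measure, sub_zero,
        Real.abs_exp]
      exact Real.exp_le_exp.2 (by nlinarith)

end

/-! ### The indicator function up to exponentially small errors -/

lemma setDist_Ioi_Icc {b c ε : ℝ} (hbc : b < c) (hε : 0 < ε) :
    setDist (Ioi c) (Icc (b - ε) b) = c - b := by
  refine IsGLB.csInf_eq ⟨?_, ?_⟩ ⟨_, mem_image2_of_mem (show c + 1 ∈ Ioi c by simp)
    (show b ∈ Icc (b - ε) b from ⟨by linarith, le_rfl⟩)⟩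
  · rintro _ ⟨x, hx, y, hy, rfl⟩
    have hx' : c < x := hx
    rw [Real.dist_eq]
    exact le_trans (by linarith [hy.2]) (le_abs_self _)
  · intro l hl
    refine le_of_forall_pos_le_add fun δ hδ => ?_
    have := hl (mem_image2_of_mem (show c + δ ∈ Ioi c by simpa using hδ)
      (show b ∈ Icc (b - ε) b from ⟨by linarith, le_rfl⟩))
    rw [Real.dist_eq, abs_of_nonneg (by linarith)] at this
    linarith

section

variable {a b T γ β : ℝ} {f : ℝ → ℝ} {u : ℝ × ℝ → ℝ}

lemma IsWeakSolution.hasDerivAt_w (hu : IsWeakSolution a T γ β f u) (hT : 0 < T) (ha : 0 < a)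
    (hb : b < 0) (hf : Integrable f) (hfb : ∀ᵐ x : ℝ, b < x → f x = 0) (τ : ℝ) :
    HasDerivAt (w T u τ) (-τ * w T u τ 0 +
      (2 * τ * (∫ s in (0 : ℝ)..T, Real.exp (-τ * s) * reflected a b T f u s)
        + Real.exp (-τ * T) * (reflected a b T f u T + 1 / 2 * primitive b f (-T)))) 0 := by
  have hP := hu.continuous_reflected hT hf (b := b)
  have hQ : Continuous fun s => -(1 / 2) * primitive b f s :=
    continuous_const.mul (continuous_primitive hf b)
  have h := HalfLineWave.hasDerivAt_w hP hQ hb ha hT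
    (fun x hx t ht => hu.eq_reflected_sub hT hf hfb hx.1 hx.2 ht) τ
  have hP0 : reflected a b T f u 0 = 0 := by
    rw [reflected, clampExt_of_nonpos hu.initial (by linarith),
      primitive_of_le hfb (by linarith)]
    simp
  rw [hP0, primitive_of_le hfb hb.le] at h
  refine h.congr_deriv ?_
  ring

/-- Here `J` is `w' + τ w` at `0`. Its trace part is `2τ e^{-τ a}` times the transform of the trace,
its other part is close to `-e^{-2τ a} F`; over the common denominator the numerator is `2τ - ((1 +
γ) τ + β) = (1 - γ) τ - β`. -/
lemma IsWeakSolution.indicatorFn_asymptotics (hu : IsWeakSolution a T γ β f u) (ha : 0 < a)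
    (haT : a < T) (hb : b < 0) (hf : Integrable f) (hfb : ∀ᵐ x : ℝ, b < x → f x = 0) :
    ∃ J : ℝ → ℝ, ∃ C : ℝ, (∀ τ, indicatorFn T f u τ = laplace f τ / (2 * τ) * J τ) ∧
      ∀ τ ≥ 1, |((1 + γ) * τ + β) * J τ
        - Real.exp (-τ * (2 * a)) * laplace f τ * ((1 - γ) * τ - β)|
          ≤ C * τ ^ 2 * Real.exp (-τ * T) := by
  have hT : 0 < T := ha.trans haT
  have hU := continuous_clampExt hT.le hu.continuousOn
  have hF := continuous_primitive hf b
  -- The reflected wave reaches `0` after a delay `a`, so the trace is needed only up to `S = T -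
  -- a`, and `e^{-τ a} e^{-τ S} = e^{-τ T}`.
  obtain ⟨C, hC⟩ := hu.laplace_trace hf hfb (hb.trans ha) (S := T - a) (by linarith) (by linarith)
  set c₁ := reflected a b T f u T + 1 / 2 * primitive b f (-T) with hc₁
  set L := ∫ y, |f y| with hL
  have hL0 : 0 ≤ L := integral_nonneg fun _ => abs_nonneg _
  refine ⟨fun τ => 2 * τ * (∫ s in (0 : ℝ)..T, Real.exp (-τ * s) * reflected a b T f u s)
    + Real.exp (-τ * T) * c₁, 2 * C + (|1 + γ| + |β|) * (L + |c₁|), fun τ => ?_, fun τ hτ => ?_⟩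
  · rw [indicatorFn, (hu.hasDerivAt_w hT ha hb hf hfb τ).deriv, (hasDerivAt_v hfb hb τ).deriv,
      v_eq hfb τ hb, mul_zero, Real.exp_zero]
    ring
  · have hτ0 : 0 < τ := by linarith
    set A := ∫ t in Ioc 0 (T - a), Real.exp (-τ * t) * clampExt a T u (a, t) with hA
    set X := τ * (∫ s in (0 : ℝ)..T, Real.exp (-τ * s) * primitive b f (2 * a - s)) with hX
    have hXle : |X + Real.exp (-τ * (2 * a)) * laplace f τ| ≤ Real.exp (-τ * T) * L :=
      abs_integral_primitive_add_le hf hfb (by linarith) hT.le τ hτ0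
    have hsplit : 2 * τ * (∫ s in (0 : ℝ)..T, Real.exp (-τ * s) * reflected a b T f u s)
        = 2 * τ * (Real.exp (-τ * a) * A) + X := by
      have e1 : ∫ s in (0 : ℝ)..T, Real.exp (-τ * s) * reflected a b T f u s
          = (∫ s in (0 : ℝ)..T, Real.exp (-τ * s) * clampExt a T u (a, s - a))
            + 1 / 2 * ∫ s in (0 : ℝ)..T, Real.exp (-τ * s) * primitive b f (2 * a - s) := by
        rw [← intervalIntegral.integral_const_mul, ← intervalIntegral.integral_add]
        · congr 1; ext s; rw [reflected]; ring
        · exact Continuous.intervalIntegrable (by fun_prop) _ _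
        · exact Continuous.intervalIntegrable (by fun_prop) _ _
      have e2 : ∫ s in (0 : ℝ)..T, Real.exp (-τ * s) * clampExt a T u (a, s - a)
          = Real.exp (-τ * a) * A := by
        have hg : Continuous fun t => Real.exp (-τ * t) * clampExt a T u (a, t) := by fun_prop
        have e3 : ∀ s, Real.exp (-τ * s) * clampExt a T u (a, s - a)
            = Real.exp (-τ * a) * (Real.exp (-τ * (s - a)) * clampExt a T u (a, s - a)) := by
          intro s
          rw [← mul_assoc, ← Real.exp_add]
          congr 2; ring
        simp only [e3]
        rw [intervalIntegral.integral_const_mul, intervalIntegral.integral_comp_sub_right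
          (fun t => Real.exp (-τ * t) * clampExt a T u (a, t)), zero_sub,
          ← intervalIntegral.integral_add_adjacent_intervals (hg.intervalIntegrable (-a) 0)
            (hg.intervalIntegrable 0 (T - a)), hA,
          ← intervalIntegral.integral_of_le (by linarith : (0 : ℝ) ≤ T - a)]
        -- Before the delay `a` has elapsed the trace is evaluated at nonpositive times, where the
        -- extension is zero.
        rw [intervalIntegral.integral_zero_ae (a := -a) (b := 0), zero_add]
        refine ae_of_all _ fun t ht => ?_
        rw [uIoc_of_le (by linarith)] at ht
        rw [clampExt_of_nonpos hu.initial ht.2, mul_zero]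
      rw [e1, e2, hX]; ring
    have hK : |(1 + γ) * τ + β| ≤ (|1 + γ| + |β|) * τ := by
      refine (abs_add_le _ _).trans ?_
      rw [abs_mul, abs_of_pos hτ0]
      nlinarith [abs_nonneg β]
    have hexp : Real.exp (-τ * a) * Real.exp (-τ * (T - a)) = Real.exp (-τ * T) := by
      rw [← Real.exp_add]; congr 1; ring
    have hexp2 : Real.exp (-τ * a) * Real.exp (-τ * a) = Real.exp (-τ * (2 * a)) := by
      rw [← Real.exp_add]; congr 1; ring
    simp only
    rw [hsplit]
    have hid : ((1 + γ) * τ + β) * (2 * τ * (Real.exp (-τ * a) * A) + X + Real.exp (-τ * T) * c₁)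
        - Real.exp (-τ * (2 * a)) * laplace f τ * ((1 - γ) * τ - β)
        = 2 * τ * Real.exp (-τ * a) * (((1 + γ) * τ + β) * A - Real.exp (-τ * a) * laplace f τ)
          + ((1 + γ) * τ + β) * (X + Real.exp (-τ * (2 * a)) * laplace f τ
            + Real.exp (-τ * T) * c₁) := by
      rw [← hexp2]; ring
    rw [hid]
    have hτ2 : τ ≤ τ ^ 2 := by nlinarith
    calc _ ≤ 2 * τ * Real.exp (-τ * a) * |((1 + γ) * τ + β) * A - Real.exp (-τ * a) * laplace f τ|
          + |(1 + γ) * τ + β| * (|X + Real.exp (-τ * (2 * a)) * laplace f τ|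
            + |Real.exp (-τ * T) * c₁|) := by
          refine (abs_add_le _ _).trans ?_
          rw [abs_mul (2 * τ * Real.exp (-τ * a)), abs_mul ((1 + γ) * τ + β),
            abs_of_pos (by positivity : 0 < 2 * τ * Real.exp (-τ * a))]
          gcongr
          exact abs_add_le _ _
      _ ≤ 2 * τ * Real.exp (-τ * a) * (C * τ * Real.exp (-τ * (T - a)))
          + (|1 + γ| + |β|) * τ * (Real.exp (-τ * T) * L + Real.exp (-τ * T) * |c₁|) := by
          rw [abs_mul (Real.exp _) c₁, Real.abs_exp]
          gcongr
          exact hC τ hτ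
      _ = 2 * C * τ ^ 2 * Real.exp (-τ * T)
          + (|1 + γ| + |β|) * (L + |c₁|) * Real.exp (-τ * T) * τ := by
          rw [← hexp]; ring
      _ ≤ 2 * C * τ ^ 2 * Real.exp (-τ * T)
          + (|1 + γ| + |β|) * (L + |c₁|) * Real.exp (-τ * T) * τ ^ 2 := by gcongr
      _ = _ := by ring

end

/-! ### Logarithmic asymptotics -/

lemma tendsto_log_div_of_bounds {g : ℝ → ℝ} {c₁ c₂ μ ν : ℝ} (hc₁ : 0 < c₁) (hc₂ : 0 < c₂)
    (h₁ : ∀ᶠ τ in atTop, c₁ * τ ^ μ ≤ g τ) (h₂ : ∀ᶠ τ in atTop, g τ ≤ c₂ * τ ^ ν) :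
    Tendsto (fun τ => Real.log (g τ) / τ) atTop (𝓝 0) := by
  have hlog : Tendsto (fun τ : ℝ => Real.log τ / τ) atTop (𝓝 0) :=
    Real.isLittleO_log_id_atTop.tendsto_div_nhds_zero
  have hlim : ∀ c κ : ℝ, Tendsto (fun τ : ℝ => (c + κ * Real.log τ) / τ) atTop (𝓝 0) := by
    intro c κ
    have h := ((tendsto_const_nhds (x := c)).div_atTop tendsto_id).add (hlog.const_mul κ)
    rw [mul_zero, add_zero] at h
    refine h.congr fun τ => ?_
    simp only [id]; ring
  refine tendsto_of_tendsto_of_tendsto_of_le_of_le' (hlim (Real.log c₁) μ) (hlim (Real.log c₂) ν)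
    ?_ ?_
  · filter_upwards [h₁, eventually_gt_atTop 0] with τ h hτ
    have hp : 0 < τ ^ μ := Real.rpow_pos_of_pos hτ μ
    rw [← Real.log_rpow hτ, ← Real.log_mul hc₁.ne' hp.ne']
    exact div_le_div_of_nonneg_right (Real.log_le_log (by positivity) h) hτ.le
  · filter_upwards [h₁, h₂, eventually_gt_atTop 0] with τ h h' hτ
    have hp : 0 < τ ^ μ := Real.rpow_pos_of_pos hτ μ
    have hp' : 0 < τ ^ ν := Real.rpow_pos_of_pos hτ ν
    rw [← Real.log_rpow hτ, ← Real.log_mul hc₂.ne' hp'.ne']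
    exact div_le_div_of_nonneg_right
      (Real.log_le_log (lt_of_lt_of_le (by positivity) h) h') hτ.le

section

variable {Φ J I : ℝ → ℝ} {a b T γ β C L c μ : ℝ}

/-- Dividing the error by `e^{-2τ a} Φ` and using `|Φ| ≥ c τ^{-μ} e^{τ b}` leaves a multiple of
`τ^{2 + μ} e^{-(T - 2a + b) τ}`; this is where `T > 2a - b` enters. -/
lemma tendsto_ratio_sub (hT : 2 * a - b < T) (hc : 0 < c)
    (hJ : ∀ τ ≥ 1, |((1 + γ) * τ + β) * J τ
      - Real.exp (-τ * (2 * a)) * Φ τ * ((1 - γ) * τ - β)| ≤ C * τ ^ 2 * Real.exp (-τ * T))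
    (hΦ : ∀ᶠ τ in atTop, c ≤ τ ^ μ * (Real.exp (-τ * b) * |Φ τ|)) :
    Tendsto (fun τ => ((1 + γ) * τ + β) * J τ * Real.exp (τ * (2 * a)) / Φ τ
      - ((1 - γ) * τ - β)) atTop (𝓝 0) := by
  have h0 := (tendsto_rpow_mul_exp_neg_mul_atTop_nhds_zero (2 + μ) (T - 2 * a + b)
    (by linarith)).const_mul (C / c)
  rw [mul_zero] at h0
  refine squeeze_zero_norm' ?_ h0
  filter_upwards [hΦ, eventually_ge_atTop 1] with τ hΦτ hτ
  have hτ0 : 0 < τ := by linarith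
  have hp : 0 < τ ^ μ := Real.rpow_pos_of_pos hτ0 μ
  have hΦ0 : 0 < |Φ τ| := by
    by_contra hn
    rw [le_antisymm (not_lt.1 hn) (abs_nonneg _)] at hΦτ
    simp at hΦτ
    linarith
  have hΦne : Φ τ ≠ 0 := abs_pos.1 hΦ0
  have hee : Real.exp (-τ * (2 * a)) * Real.exp (τ * (2 * a)) = 1 := by
    rw [← Real.exp_add]; simp
  have e1 : ((1 + γ) * τ + β) * J τ * Real.exp (τ * (2 * a)) / Φ τ - ((1 - γ) * τ - β)
      = (((1 + γ) * τ + β) * J τ - Real.exp (-τ * (2 * a)) * Φ τ * ((1 - γ) * τ - β))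
        * Real.exp (τ * (2 * a)) / Φ τ := by
    rw [eq_div_iff hΦne, sub_mul, div_mul_cancel₀ _ hΦne]
    linear_combination Φ τ * ((1 - γ) * τ - β) * hee
  rw [e1, norm_div, norm_mul, Real.norm_eq_abs, Real.norm_eq_abs, Real.norm_eq_abs, Real.abs_exp,
    div_le_iff₀ hΦ0]
  have hC : 0 ≤ C * τ ^ 2 * Real.exp (-τ * T) := (abs_nonneg _).trans (hJ τ hτ)
  calc _ ≤ C * τ ^ 2 * Real.exp (-τ * T) * Real.exp (τ * (2 * a)) := by
        gcongr; exact hJ τ hτ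
    _ ≤ C * τ ^ 2 * Real.exp (-τ * T) * Real.exp (τ * (2 * a)) *
        ((τ ^ μ * (Real.exp (-τ * b) * |Φ τ|)) / c) :=
        le_mul_of_one_le_right (by positivity) ((one_le_div hc).2 hΦτ)
    _ = _ := by
        rw [Real.rpow_add hτ0, Real.rpow_two, show -(T - 2 * a + b) * τ
          = -τ * T + τ * (2 * a) + -τ * b by ring, Real.exp_add, Real.exp_add]
        ring

/-- The sign and the exponential decay rate of `I = Φ J / (2 τ)`, once the leading coefficient
`ℓ τ ^ κ` of `(1 - γ) τ - β` is known. -/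
lemma sign_and_decay (hT : 2 * a - b < T) (hγ : 0 ≤ γ) (hc : 0 < c)
    (hI : ∀ τ, I τ = Φ τ / (2 * τ) * J τ)
    (hJ : ∀ τ ≥ 1, |((1 + γ) * τ + β) * J τ
      - Real.exp (-τ * (2 * a)) * Φ τ * ((1 - γ) * τ - β)| ≤ C * τ ^ 2 * Real.exp (-τ * T))
    (hΦ : ∀ᶠ τ in atTop, c ≤ τ ^ μ * (Real.exp (-τ * b) * |Φ τ|))
    (hΦL : ∀ τ ≥ 1, |Φ τ| ≤ Real.exp (τ * b) * L)
    {ℓ κ : ℝ} (hκ : 0 ≤ κ) (hℓ : ℓ ≠ 0)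
    (hlead : Tendsto (fun τ => ((1 - γ) * τ - β) / τ ^ κ) atTop (𝓝 ℓ)) :
    (0 < ℓ → ∃ τ₀ > 0, ∀ τ ≥ τ₀, 0 < I τ) ∧ (ℓ < 0 → ∃ τ₀ > 0, ∀ τ ≥ τ₀, I τ < 0) ∧
      Tendsto (fun τ : ℝ => 1 / (2 * τ) * Real.log |I τ|) atTop (𝓝 (-(a - b))) := by
  set m : ℝ → ℝ := fun τ => ((1 + γ) * τ + β) * J τ * Real.exp (τ * (2 * a)) / Φ τ with hm
  have hm1 : Tendsto (fun τ => m τ / τ ^ κ) atTop (𝓝 ℓ) := by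
    have h1 := (tendsto_ratio_sub hT hc hJ hΦ)
    have h2 : Tendsto (fun τ => (m τ - ((1 - γ) * τ - β)) / τ ^ κ) atTop (𝓝 0) := by
      refine squeeze_zero_norm' ?_ (tendsto_norm_zero.comp h1)
      filter_upwards [eventually_ge_atTop 1] with τ hτ
      rw [norm_div]
      refine div_le_self (norm_nonneg _) ?_
      rw [Real.norm_eq_abs, abs_of_nonneg (by positivity)]
      exact Real.one_le_rpow hτ hκ
    have h3 := h2.add hlead
    rw [zero_add] at h3
    refine h3.congr fun τ => ?_
    rw [← add_div, sub_add_cancel]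
  have hKev : ∀ᶠ τ : ℝ in atTop, 1 ≤ (1 + γ) * τ + β := by
    filter_upwards [eventually_ge_atTop (1 - β), eventually_ge_atTop 0] with τ h1 h2
    nlinarith
  have hΦne : ∀ᶠ τ in atTop, Φ τ ≠ 0 := by
    filter_upwards [hΦ] with τ h h0
    rw [h0] at h
    simp at h
    linarith
  -- Both factors `Φ` combine to a square, so the sign of `I` is that of `m` whatever the sign of
  -- `Φ`.
  have hIm : ∀ᶠ τ in atTop, I τ
      = Φ τ ^ 2 * Real.exp (-τ * (2 * a)) / (2 * τ * ((1 + γ) * τ + β)) * m τ := by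
    filter_upwards [hKev, hΦne, eventually_gt_atTop 0] with τ h1 h2 hτ
    have hK : (1 + γ) * τ + β ≠ 0 := by linarith
    have hee : Real.exp (-τ * (2 * a)) * Real.exp (τ * (2 * a)) = 1 := by
      rw [← Real.exp_add]; simp
    rw [hI]
    simp only [hm]
    generalize (1 + γ) * τ + β = K at hK ⊢
    calc Φ τ / (2 * τ) * J τ
        = Φ τ / (2 * τ) * J τ * (Real.exp (-τ * (2 * a)) * Real.exp (τ * (2 * a))) := by
          rw [hee, mul_one]
      _ = _ := by field_simp
  have hpos : ∀ᶠ τ in atTop,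
      0 < Φ τ ^ 2 * Real.exp (-τ * (2 * a)) / (2 * τ * ((1 + γ) * τ + β)) := by
    filter_upwards [hKev, hΦne, eventually_gt_atTop 0] with τ h1 h2 hτ
    have hK : 0 < (1 + γ) * τ + β := by linarith
    positivity
  have hex : ∀ {p : ℝ → Prop}, (∀ᶠ τ in atTop, p τ) → ∃ τ₀ > 0, ∀ τ ≥ τ₀, p τ := by
    intro p hp
    obtain ⟨N, hN⟩ := eventually_atTop.1 hp
    exact ⟨max N 1, lt_max_of_lt_right one_pos, fun τ hτ => hN τ ((le_max_left _ _).trans hτ)⟩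
  refine ⟨fun h => hex ?_, fun h => hex ?_, ?_⟩
  · filter_upwards [hIm, hpos, hm1.eventually_const_lt h, eventually_gt_atTop 0]
      with τ h1 h2 h3 hτ
    rw [h1]
    exact mul_pos h2 ((div_pos_iff_of_pos_right (Real.rpow_pos_of_pos hτ κ)).1 h3)
  · filter_upwards [hIm, hpos, hm1.eventually_lt_const h, eventually_gt_atTop 0]
      with τ h1 h2 h3 hτ
    rw [h1]
    refine mul_neg_of_pos_of_neg h2 ?_
    by_contra hn
    exact absurd (div_nonneg (not_lt.1 hn) (Real.rpow_nonneg hτ.le κ)) (not_le.2 h3)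
  · have hℓ' : 0 < |ℓ| := abs_pos.2 hℓ
    have hL : 0 < |L| + 1 := by positivity
    have g1 : Tendsto (fun τ => Real.log (Real.exp (-τ * b) * |Φ τ|) / τ) atTop (𝓝 0) := by
      refine tendsto_log_div_of_bounds (c₁ := c) (c₂ := |L| + 1) (μ := -μ) (ν := 0) hc hL ?_ ?_
      · filter_upwards [hΦ, eventually_gt_atTop 0] with τ h hτ
        rw [Real.rpow_neg hτ.le, ← div_eq_mul_inv, div_le_iff₀' (Real.rpow_pos_of_pos hτ μ)]
        exact h
      · filter_upwards [eventually_ge_atTop 1] with τ hτ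
        rw [Real.rpow_zero, mul_one]
        calc Real.exp (-τ * b) * |Φ τ| ≤ Real.exp (-τ * b) * (Real.exp (τ * b) * L) := by
              gcongr; exact hΦL τ hτ
          _ = L := by rw [← mul_assoc, ← Real.exp_add]; simp
          _ ≤ _ := by linarith [le_abs_self L]
    have g2 : Tendsto (fun τ => Real.log |m τ| / τ) atTop (𝓝 0) := by
      have hab := hm1.abs
      refine tendsto_log_div_of_bounds (c₁ := |ℓ| / 2) (c₂ := 2 * |ℓ|) (μ := κ) (ν := κ)
        (by positivity) (by positivity) ?_ ?_
      · filter_upwards [hab.eventually_const_lt (half_lt_self hℓ'), eventually_gt_atTop 0]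
          with τ h hτ
        have hp := Real.rpow_pos_of_pos hτ κ
        rw [abs_div, abs_of_pos hp, lt_div_iff₀ hp] at h
        exact h.le
      · filter_upwards [hab.eventually_lt_const (show |ℓ| < 2 * |ℓ| by linarith),
          eventually_gt_atTop 0] with τ h hτ
        have hp := Real.rpow_pos_of_pos hτ κ
        rw [abs_div, abs_of_pos hp, div_lt_iff₀ hp] at h
        exact h.le
    have g3 : Tendsto (fun τ => Real.log (2 * τ * ((1 + γ) * τ + β)) / τ) atTop (𝓝 0) := by
      refine tendsto_log_div_of_bounds (c₁ := 1) (c₂ := 2 * (1 + γ + |β|)) (μ := 0) (ν := 2)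
        one_pos (by positivity) ?_ ?_
      · filter_upwards [hKev, eventually_ge_atTop 1] with τ h hτ
        rw [Real.rpow_zero]
        nlinarith
      · filter_upwards [eventually_ge_atTop 1] with τ hτ
        rw [Real.rpow_two]
        have h1 : β ≤ |β| * τ := by nlinarith [le_abs_self β, abs_nonneg β]
        nlinarith
    -- In `log |I| / (2τ)` the square of `Φ` yields `b`, the factor `e^{-2τ a}` yields `-a`, and
    -- everything else is of polynomial size.
    have g := ((g1.add (g2.const_mul (1 / 2))).sub (g3.const_mul (1 / 2))).add_const (-(a - b))
    simp only [mul_zero, add_zero, sub_zero, zero_add] at g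
    refine g.congr' ?_
    filter_upwards [hIm, hKev, hΦne, eventually_gt_atTop 0,
      hm1.eventually_ne hℓ, hpos] with τ h1 h2 h3 hτ h4 h5
    have hm0 : |m τ| ≠ 0 := by
      rw [abs_ne_zero]; intro h; rw [h, zero_div] at h4; exact h4 rfl
    have hK : 0 < 2 * τ * ((1 + γ) * τ + β) := by
      have : 0 < (1 + γ) * τ + β := by linarith
      positivity
    have hΦa : |Φ τ| ≠ 0 := abs_ne_zero.2 h3
    have hsq : Real.log (Φ τ ^ 2) = 2 * Real.log |Φ τ| := by
      rw [Real.log_pow, Real.log_abs]; norm_num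
    rw [h1, abs_mul _ (m τ), abs_of_pos h5, Real.log_mul h5.ne' hm0,
      Real.log_div (by positivity) hK.ne',
      Real.log_mul (by positivity) (Real.exp_pos _).ne', hsq, Real.log_exp,
      Real.log_mul (Real.exp_pos _).ne' hΦa, Real.log_exp]
    field_simp
    ring

end

/-! ### Consequences of the hypotheses on `f`, and the theorem -/

/-- The integral in the hypothesis is `e^{-τ b} F(τ)`. Choosing `c` strictly between `0` and the
lower limit, hence finite even if that limit is `∞`, gives a real bound. -/
lemma NonDegenerate.eventually_le {b ε : ℝ} {f : ℝ → ℝ} (h : NonDegenerate b ε f) (hε : 0 < ε)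
    (hsupp : ∀ᵐ x : ℝ, x ∉ source b ε → f x = 0) :
    ∃ μ c : ℝ, 0 < c ∧ ∀ᶠ τ in atTop, c ≤ τ ^ μ * (Real.exp (-τ * b) * |laplace f τ|) := by
  obtain ⟨μ, hμ⟩ := h
  obtain ⟨c, hc0, hc⟩ := exists_between hμ
  have hctop : c ≠ ⊤ := hc.ne_top
  refine ⟨μ, c.toReal, ENNReal.toReal_pos hc0.ne' hctop, ?_⟩
  filter_upwards [eventually_lt_of_lt_liminf hc] with τ hτ
  have e : ∫ y in (b - ε)..b, Real.exp (-τ * (b - y)) * f y = Real.exp (-τ * b) * laplace f τ := by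
    rw [intervalIntegral.integral_of_le (by linarith), ← integral_Icc_eq_integral_Ioc,
      setIntegral_eq_integral_of_ae_compl_eq_zero, laplace, ← integral_const_mul]
    · refine integral_congr_ae (ae_of_all _ fun y => ?_)
      simp only
      rw [← mul_assoc, ← Real.exp_add]
      congr 2; ring
    · filter_upwards [hsupp] with y hy hyn
      rw [hy hyn, mul_zero]
  rw [e, abs_mul, Real.abs_exp] at hτ
  exact ((ENNReal.lt_ofReal_iff_toReal_lt hctop).1 hτ).le

lemma integrable_of_memLp_of_ae_eq_zero {b ε : ℝ} {f : ℝ → ℝ} (hf : MemLp f 2 volume)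
    (hsupp : ∀ᵐ x : ℝ, x ∉ source b ε → f x = 0) : Integrable f := by
  have h1 : IntegrableOn f (source b ε) :=
    (hf.restrict _).integrable (μ := volume.restrict (Icc (b - ε) b)) (by norm_num)
  refine (h1.integrable_indicator measurableSet_Icc).congr ?_
  filter_upwards [hsupp] with x hx
  by_cases h : x ∈ source b ε
  · rw [indicator_of_mem h]
  · rw [indicator_of_notMem h, hx h]

end HalfLineWave

theorem theorem4p1 (a b ε T γ β : ℝ) (ha : 0 < a) (hb : b < 0) (hε : 0 < ε) (hγ : 0 ≤ γ)
    (f : ℝ → ℝ) (hf : MemLp f 2 volume)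
    (hsupp : ∀ᵐ x : ℝ, x ∉ HalfLineWave.source b ε → f x = 0)
    (hnd : HalfLineWave.NonDegenerate b ε f)
    (hT : 2 * HalfLineWave.setDist (HalfLineWave.obstacle a) (HalfLineWave.source b ε)
      - HalfLineWave.setDist HalfLineWave.observed (HalfLineWave.source b ε) < T)
    (u : ℝ × ℝ → ℝ) (hu : HalfLineWave.IsWeakSolution a T γ β f u) :
    (∀ τ > 0, DifferentiableAt ℝ (HalfLineWave.v f τ) 0 ∧
      DifferentiableAt ℝ (HalfLineWave.w T u τ) 0) ∧
    (γ ≠ 1 →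
      (γ < 1 → ∃ τ₀ > 0, ∀ τ ≥ τ₀, 0 < HalfLineWave.indicatorFn T f u τ) ∧
      (1 < γ → ∃ τ₀ > 0, ∀ τ ≥ τ₀, HalfLineWave.indicatorFn T f u τ < 0) ∧
      Tendsto (fun τ : ℝ => 1 / (2 * τ) * Real.log |HalfLineWave.indicatorFn T f u τ|) atTop
        (𝓝 (-HalfLineWave.setDist (HalfLineWave.obstacle a) (HalfLineWave.source b ε)))) ∧
    (γ = 1 → β ≠ 0 →
      (β < 0 → ∃ τ₀ > 0, ∀ τ ≥ τ₀, 0 < HalfLineWave.indicatorFn T f u τ) ∧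
      (0 < β → ∃ τ₀ > 0, ∀ τ ≥ τ₀, HalfLineWave.indicatorFn T f u τ < 0) ∧
      Tendsto (fun τ : ℝ => 1 / (2 * τ) * Real.log |HalfLineWave.indicatorFn T f u τ|) atTop
        (𝓝 (-HalfLineWave.setDist (HalfLineWave.obstacle a) (HalfLineWave.source b ε)))) := by
  have hfi : Integrable f := HalfLineWave.integrable_of_memLp_of_ae_eq_zero hf hsupp
  have hfb : ∀ᵐ x : ℝ, b < x → f x = 0 := by
    filter_upwards [hsupp] with x hx hbx
    exact hx fun h => absurd h.2 (not_le.2 hbx)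
  rw [show HalfLineWave.setDist HalfLineWave.observed (HalfLineWave.source b ε) = 0 - b from
    HalfLineWave.setDist_Ioi_Icc hb hε] at hT
  rw [show HalfLineWave.setDist (HalfLineWave.obstacle a) (HalfLineWave.source b ε) = a - b from
    HalfLineWave.setDist_Ioi_Icc (hb.trans ha) hε] at hT ⊢
  have hT' : 2 * a - b < T := by linarith
  have haT : a < T := by linarith
  obtain ⟨μ, c, hc, hΦ⟩ := hnd.eventually_le hε hsupp
  obtain ⟨J, C, hI, hJ⟩ := hu.indicatorFn_asymptotics ha haT hb hfi hfb
  have hmain := fun {ℓ κ : ℝ} (hκ : 0 ≤ κ) (hℓ : ℓ ≠ 0) hlead =>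
    HalfLineWave.sign_and_decay hT' hγ hc hI hJ hΦ
      (fun τ hτ => HalfLineWave.abs_laplace_le hfi hfb (zero_le_one.trans hτ))
      (ℓ := ℓ) (κ := κ) hκ hℓ hlead
  refine ⟨fun τ _ => ⟨(HalfLineWave.hasDerivAt_v hfb hb τ).differentiableAt,
    (hu.hasDerivAt_w (ha.trans haT) ha hb hfi hfb τ).differentiableAt⟩, fun h1 => ?_,
    fun h1 hβ => ?_⟩
  -- For `γ ≠ 1` the leading term of `(1 - γ) τ - β` is linear: `κ = 1`, `ℓ = 1 - γ`.
  · have hlead : Tendsto (fun τ : ℝ => ((1 - γ) * τ - β) / τ ^ (1 : ℝ)) atTop (𝓝 (1 - γ)) := by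
      have h := ((tendsto_const_nhds (x := β)).div_atTop tendsto_id).const_sub (1 - γ)
      rw [sub_zero] at h
      refine h.congr' ?_
      filter_upwards [eventually_gt_atTop 0] with τ hτ
      rw [Real.rpow_one, id]
      field_simp
    obtain ⟨p, n, l⟩ := hmain zero_le_one (sub_ne_zero.2 h1.symm) hlead
    exact ⟨fun h => p (by linarith), fun h => n (by linarith), l⟩
  -- For `γ = 1` only the constant `-β` remains: `κ = 0`, `ℓ = -β`.
  · have hlead : Tendsto (fun τ : ℝ => ((1 - γ) * τ - β) / τ ^ (0 : ℝ)) atTop (𝓝 (-β)) := by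
      simp [h1]
    obtain ⟨p, n, l⟩ := hmain le_rfl (neg_ne_zero.2 hβ) hlead
    exact ⟨fun h => p (by linarith), fun h => n (by linarith), l⟩
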